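/- All matroids are finite. Let $\mathbb F$ be an infinite field. A matroid is $\mathbb F$-representable if it is isomorphic to the vector matroid of a matrix over $\mathbb F$; an excluded minor for $\mathbb F$-representability is a matroid that is not $\mathbb F$-representable although each of its proper minors is. A principal extension of a matroid $M$ into a flat $F$ of $M$ is a matroid $M'$ on a ground set $E(M)\cup\{e\}$ with $e\notin E(M)$ such that $M'\setminus e=M$ and a subset of $E(M)$ spans $e$ in $M'$ if and only if it spans $F$ in $M$. A class of matroids is natural if it is closed under isomorphism, minors, adding coloops, principal extensions and direct sums. Theorem 1.3. Let $\mathbb F$ be an infinite field and let $\mathcal M$ be a natural class of matroids that properly contains the class of $\mathbb F$-representable matroids. Then every $\mathbb F$-representable matroid is (isomorphic to) a minor of an excluded minor for $\mathbb F$-representability that is contained in $\mathcal M$. -/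

import Mathlib

universe u v

namespace Matroid

/-- Two matroids are isomorphic: some bijection between the ground sets carries the one to the
other, that is, preserves independence in both directions. -/
def IsIsomorphic {α : Type u} {β : Type v} (M : Matroid α) (N : Matroid β) : Prop :=
  ∃ e : M.E ≃ N.E, M.mapSetEquiv e = N

/-- `M` is representable over the field `F`: it is the vector matroid of a matrix over `F` with
`n` rows whose columns `v e` are labelled by the elements `e` of `M`. -/
def IsRepresentable {α : Type u} (M : Matroid α) (F : Type v) [Field F] : Prop :=
  ∃ (n : ℕ) (v : α → (Fin n → F)), ∀ I ⊆ M.E, M.Indep I ↔ LinearIndepOn F v I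

/-- `M` is an excluded minor for `F`-representability: a finite matroid that is not representable
over `F`, although each of its proper minors is. -/
structure IsExcludedMinorForRepresentability {α : Type u} (M : Matroid α)
    (F : Type v) [Field F] : Prop where
  finite : M.Finite
  not_isRepresentable : ¬ M.IsRepresentable F
  isRepresentable_of_isStrictMinor : ∀ N : Matroid α, N.IsStrictMinor M → N.IsRepresentable F

/-- `M'` is obtained from `M` by adding the new element `e` as a coloop. -/
structure IsColoopExtension {α : Type u} (M M' : Matroid α) (e : α) : Prop where
  notMem_ground : e ∉ M.E
  isColoop : M'.IsColoop e
  delete_eq : M'.delete {e} = M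

/-- `M'` is the principal extension of `M` into the flat `F` by the new element `e`: its ground
set is `E(M) ∪ {e}`, deleting `e` gives `M`, and a subset of `E(M)` spans `e` in `M'` if and only
if it spans `F` in `M`. -/
structure IsPrincipalExtension {α : Type u} (M M' : Matroid α) (F : Set α) (e : α) : Prop where
  isFlat : M.IsFlat F
  notMem_ground : e ∉ M.E
  ground_eq : M'.E = insert e M.E
  delete_eq : M'.delete {e} = M
  mem_closure_iff : ∀ X ⊆ M.E, e ∈ M'.closure X ↔ F ⊆ M.closure X

end Matroid

/-- A class of matroids, as a predicate on the matroids on all types of a universe. -/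
def MatroidClass : Type (u + 1) := ∀ α : Type u, Matroid α → Prop

/-- A natural class of (finite) matroids: it is closed under isomorphism, minors, adding coloops,
principal extensions and direct sums. -/
structure MatroidClass.IsNatural (𝓜 : MatroidClass.{u}) : Prop where
  finite : ∀ (α : Type u) (M : Matroid α), 𝓜 α M → M.Finite
  isomorphic : ∀ (α β : Type u) (M : Matroid α) (N : Matroid β),
    𝓜 α M → M.IsIsomorphic N → 𝓜 β N
  minor : ∀ (α : Type u) (M N : Matroid α), 𝓜 α M → N.IsMinor M → 𝓜 α N
  coloopExtension : ∀ (α : Type u) (M M' : Matroid α) (e : α),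
    𝓜 α M → M.IsColoopExtension M' e → 𝓜 α M'
  principalExtension : ∀ (α : Type u) (M M' : Matroid α) (F : Set α) (e : α),
    𝓜 α M → M.IsPrincipalExtension M' F e → 𝓜 α M'
  directSum : ∀ (α β : Type u) (M : Matroid α) (N : Matroid β),
    𝓜 α M → 𝓜 β N → 𝓜 (α ⊕ β) (M.sum N)

/-- `𝓜` properly contains the class of all (finite) `F`-representable matroids. -/
def MatroidClass.ProperlyContainsRepresentable (𝓜 : MatroidClass.{u})
    (F : Type v) [Field F] : Prop :=
  (∀ (α : Type u) (M : Matroid α), M.Finite → M.IsRepresentable F → 𝓜 α M) ∧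
    ∃ (α : Type u) (M : Matroid α), 𝓜 α M ∧ ¬ M.IsRepresentable F

/-! A minimal non-representable restriction of a member of `𝓜` is an extension `K` of a
representable matroid `Z` by one element `e` (`exists_minimal_extension`). Here `e` is not a coloop,
so `K` is determined by `Z` and the hyperplanes of `Z` that span `e`. Let `L` be a minimal set of
hyperplanes on which no representable extension of `Z` of the same rank agrees with `K`; it has at
least two members (`exists_minimal_not_agreeableOn`).

A gadget `M` encodes this disagreement (`exists_gadget`). Add coloops to `K`. For each `S ∈ L` and
`x ∈ S`, place an element freely on the line through `x` and a coloop of its own: all these elements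
are jointly independent, yet modulo the coloops those over `S` are a copy of `S`. Place `p` freely
in the span of `e` and the coloops; modulo the coloops it is parallel to `e`. Take a representable
matroid of rank `k`, partitioned into spanning circuits indexed by `L`, and replace each element `y`
of the circuit of `S` by an element free in the span of `y`, `p` and the elements over `S`. Finally
delete `e`, `p` and the old `y`. These operations stay inside `𝓜`, and they preserve
representability when `K` is replaced by a representable extension.

`M` is not representable: in a representation, the spans of circuit and elements over `S`, for the
various `S`, meet in one subspace. It contains a point playing the role of `p`, which modulo the
coloops extends `Z` in agreement with `K` on `L` (`exists_common_point`,
`exists_representable_extension`).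

Whether `S` spans `e` only affects ranks of sets that meet the circuit elements exactly in the
circuit of `S` (`gadgetRk_eq_of_agree`). By minimality of `L`, deleting or contracting any circuit
element therefore leaves a representable matroid. So an excluded minor inside `M` keeps all circuit
elements. The circuits are chosen so that the target matroid is hidden in each of many blocks, more
than the rank of the rest of `M`; by pigeonhole one block survives undisturbed
(`exists_isMinor_of_blocks`). -/

open Set

namespace Matroid

/-! ### Rank as a natural number on finite types -/

section Rank

variable {γ : Type*}

/-- The rank of a set as a natural number. -/
noncomputable def rk (M : Matroid γ) (X : Set γ) : ℕ := (M.eRk X).toNat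

variable (M : Matroid γ)

@[simp] lemma rk_empty : M.rk ∅ = 0 := by simp [rk]

lemma rk_closure (X : Set γ) : M.rk (M.closure X) = M.rk X := by simp [rk]

variable [Finite γ]

/-- On a finite type no rank is `⊤`, so `toNat` loses nothing. -/
lemma coe_rk (X : Set γ) : (M.rk X : ℕ∞) = M.eRk X :=
  ENat.natCast_toNat (eRk_ne_top_iff.2 (RankFinite.isRkFinite X))

lemma coe_ncard_eq (X : Set γ) : (X.ncard : ℕ∞) = X.encard := X.toFinite.cast_ncard_eq

variable {M} in
lemma rk_mono {X Y : Set γ} (h : X ⊆ Y) : M.rk X ≤ M.rk Y := by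
  have := M.eRk_mono h
  rwa [← coe_rk, ← coe_rk, Nat.cast_le] at this

lemma rk_le_ncard (X : Set γ) : M.rk X ≤ X.ncard := by
  have := M.eRk_le_encard X
  rwa [← coe_rk, ← coe_ncard_eq, Nat.cast_le] at this

lemma rk_inter_add_rk_union_le (X Y : Set γ) :
    M.rk (X ∩ Y) + M.rk (X ∪ Y) ≤ M.rk X + M.rk Y := by
  have := M.eRk_inter_add_eRk_union_le X Y
  simp only [← coe_rk] at this
  exact_mod_cast this

lemma rk_union_le (X Y : Set γ) : M.rk (X ∪ Y) ≤ M.rk X + M.rk Y := by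
  have := M.rk_inter_add_rk_union_le X Y
  omega

lemma rk_union_le_ncard (X Y : Set γ) : M.rk (X ∪ Y) ≤ M.rk X + Y.ncard :=
  (M.rk_union_le X Y).trans (Nat.add_le_add_left (M.rk_le_ncard Y) _)

lemma rk_insert_le (x : γ) (X : Set γ) : M.rk (insert x X) ≤ M.rk X + 1 := by
  have := M.rk_union_le_ncard X {x}
  rwa [union_singleton, ncard_singleton] at this

variable {M} in
lemma indep_iff_rk {I : Set γ} : M.Indep I ↔ M.rk I = I.ncard := by
  rw [indep_iff_eRk_eq_encard, ← coe_rk, ← coe_ncard_eq, Nat.cast_inj]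

variable {M} in
lemma mem_closure_iff_rk {x : γ} {X : Set γ} (hx : x ∈ M.E) :
    x ∈ M.closure X ↔ M.rk (insert x X) = M.rk X := by
  constructor
  · intro h
    refine le_antisymm ?_ (rk_mono (subset_insert _ _))
    rw [← M.rk_closure X, ← M.rk_closure (insert x X), M.closure_insert_eq_of_mem_closure h]
  · intro h
    by_contra hc
    have := M.eRk_insert_eq_add_one (e := x) (X := X) ⟨hx, hc⟩
    simp only [← coe_rk] at this
    have : M.rk (insert x X) = M.rk X + 1 := by exact_mod_cast this
    omega

lemma exists_indep_rk (X : Set γ) : ∃ I ⊆ X, M.Indep I ∧ I.ncard = M.rk X := by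
  obtain ⟨I, hI⟩ := M.exists_isBasis' X
  refine ⟨I, hI.subset, hI.indep, ?_⟩
  have := hI.encard_eq_eRk
  rw [← coe_rk, ← coe_ncard_eq] at this
  exact_mod_cast this

lemma rk_union_eq_of_forall {X Y : Set γ} (h : ∀ y ∈ Y, M.rk (insert y X) = M.rk X) :
    M.rk (X ∪ Y) = M.rk X := by
  induction Y, Y.toFinite using Set.Finite.induction_on with
  | empty => simp
  | @insert a s _ _ ih =>
    have h1 := ih fun y hy ↦ h y (mem_insert_of_mem _ hy)
    have h2 := h a (mem_insert _ _)
    have h3 := M.rk_inter_add_rk_union_le (insert a X) (X ∪ s)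
    have h4 : M.rk X ≤ M.rk (insert a X ∩ (X ∪ s)) :=
      rk_mono (subset_inter (subset_insert _ _) subset_union_left)
    have h5 : M.rk (X ∪ insert a s) ≤ M.rk (insert a X ∪ (X ∪ s)) :=
      rk_mono (by intro x; simp; tauto)
    have h6 : M.rk X ≤ M.rk (X ∪ insert a s) := rk_mono subset_union_left
    omega

lemma ext_rk {M N : Matroid γ} (hM : M.E = univ) (hN : N.E = univ)
    (h : ∀ X, M.rk X = N.rk X) : M = N := by
  refine ext_indep (hM.trans hN.symm) fun I _ ↦ ?_
  rw [indep_iff_rk, indep_iff_rk, h]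

end Rank

/-! ### Isomorphism and pullback along injections -/

section Iso

variable {α : Type*} {β : Type*} {M : Matroid α} {N : Matroid β}

lemma isIsomorphic_iff : M.IsIsomorphic N ↔ ∃ e : M.E ≃ N.E, ∀ T : Set M.E,
    M.Indep ((↑) '' T) ↔ N.Indep ((↑) '' (e '' T)) := by
  refine exists_congr fun e ↦ ⟨?_, fun h ↦ ?_⟩
  · intro h T
    have := congrArg (fun P ↦ P.Indep ((↑) '' (e '' T))) h
    simp only [mapSetEquiv_indep_iff, eq_iff_iff] at this
    rw [← this]
    have h1 : ((↑) ⁻¹' ((↑) '' (e '' T) : Set β) : Set N.E) = e '' T :=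
      preimage_image_eq _ Subtype.val_injective
    rw [h1]
    have h2 : (↑) '' (e '' T) ⊆ N.E := by simp
    simp only [h2, and_true]
    rw [← image_comp e.symm e]
    simp
  · refine ext_indep (by simp) fun I hI ↦ ?_
    rw [mapSetEquiv.ground] at hI
    rw [mapSetEquiv_indep_iff, h]
    have h1 : (e '' (e.symm '' ((↑) ⁻¹' I : Set N.E))) = ((↑) ⁻¹' I : Set N.E) := by simp [image_image]
    rw [h1, Subtype.image_preimage_coe, inter_eq_self_of_subset_right hI]
    simp [hI]

lemma IsIsomorphic.symm (h : M.IsIsomorphic N) : N.IsIsomorphic M := by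
  obtain ⟨e, he⟩ := isIsomorphic_iff.1 h
  refine isIsomorphic_iff.2 ⟨e.symm, fun T ↦ ?_⟩
  rw [he]
  simp [image_image]

/-- Allows auxiliary elements to be deleted by `comap` along an injection, so that the ground set
can again be all of a type. -/
lemma comap_isIsomorphic_restrict {f : α → β} (hf : Function.Injective f) :
    (N.comap f).IsIsomorphic (N ↾ (range f ∩ N.E)) := by
  let e : (N.comap f).E ≃ (N ↾ (range f ∩ N.E)).E :=
    Equiv.ofBijective (fun x ↦ ⟨f x, mem_range_self _, x.2⟩) <| by
      constructor
      · intro x y h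
        exact Subtype.ext (hf (congrArg Subtype.val h))
      · rintro ⟨_, ⟨x, rfl⟩, h⟩
        exact ⟨⟨x, h⟩, rfl⟩
  refine isIsomorphic_iff.2 ⟨e, fun T ↦ ?_⟩
  have h1 : (Subtype.val '' (e '' T)) = f '' ((↑) '' T) := by
    simp only [image_image]; rfl
  rw [h1, comap_indep_iff, restrict_indep_iff]
  have h2 : f '' ((↑) '' T) ⊆ range f ∩ N.E := by
    rintro _ ⟨_, ⟨x, _, rfl⟩, rfl⟩
    exact ⟨mem_range_self _, x.2⟩
  rw [and_iff_left hf.injOn, and_iff_left h2]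

end Iso

/-! ### Closure properties of representability -/

section Representable

variable {α : Type u} {F : Type v} [Field F]

lemma linearIndepOn_image {ι ι' V : Type*} [AddCommGroup V] [Module F V] {f : ι → ι'}
    {g : ι' → V} {s : Set ι} (hf : InjOn f s) :
    LinearIndepOn F g (f '' s) ↔ LinearIndepOn F (g ∘ f) s :=
  ⟨fun h ↦ h.comp_of_image hf, fun h ↦ h.image_of_comp⟩

lemma isRepresentable_of_linearIndepOn {V : Type*} [AddCommGroup V] [Module F V]
    [FiniteDimensional F V] {M : Matroid α} (w : α → V)
    (h : ∀ I ⊆ M.E, M.Indep I ↔ LinearIndepOn F w I) : M.IsRepresentable F := by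
  obtain ⟨n, φ, hφ⟩ : ∃ n, ∃ φ : V →ₗ[F] (Fin n → F), LinearMap.ker φ = ⊥ :=
    ⟨_, _, (Module.finBasis F V).equivFun.ker⟩
  exact ⟨n, fun x ↦ φ (w x), fun I hI ↦ (h I hI).trans
    (LinearMap.linearIndependent_iff (v := fun x : I ↦ w x) φ hφ).symm⟩

lemma IsRepresentable.of_isIsomorphic {β : Type*} {M : Matroid α} {N : Matroid β}
    (hM : M.IsRepresentable F) (h : M.IsIsomorphic N) : N.IsRepresentable F := by
  classical
  obtain ⟨n, w, hw⟩ := hM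
  obtain ⟨e, he⟩ := isIsomorphic_iff.1 h
  refine ⟨n, fun b ↦ if hb : b ∈ N.E then w (e.symm ⟨b, hb⟩) else 0, fun I hI ↦ ?_⟩
  obtain ⟨T, rfl⟩ : ∃ T : Set M.E, I = (↑) '' (e '' T) := by
    refine ⟨e.symm '' ((↑) ⁻¹' I : Set N.E), ?_⟩
    simp [image_image, inter_eq_self_of_subset_right hI]
  rw [← he, hw _ (by simp), ← image_comp, linearIndepOn_image Subtype.val_injective.injOn,
    linearIndepOn_image (Subtype.val_injective.comp e.injective).injOn]
  refine linearIndepOn_congr fun x _ ↦ ?_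
  simp

lemma IsRepresentable.mem_closure_iff {M : Matroid α} {n : ℕ} {w : α → (Fin n → F)}
    (hw : ∀ I ⊆ M.E, M.Indep I ↔ LinearIndepOn F w I) {I : Set α} (hI : M.Indep I) {x : α}
    (hx : x ∈ M.E) : x ∈ M.closure I ↔ w x ∈ Submodule.span F (w '' I) := by
  rw [hI.mem_closure_iff', ((hw I hI.subset_ground).1 hI).mem_span_iff,
    hw _ (insert_subset hx hI.subset_ground)]
  simp [hx]

end Representable
section Representable

variable {α : Type u} {F : Type v} [Field F]

lemma IsRepresentable.delete {M : Matroid α} (hM : M.IsRepresentable F) (D : Set α) :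
    (M ＼ D).IsRepresentable F := by
  obtain ⟨n, w, hw⟩ := hM
  refine ⟨n, w, fun I hI ↦ ?_⟩
  rw [delete_ground, subset_sdiff] at hI
  rw [delete_indep_iff, hw I hI.1, and_iff_left hI.2]

/-- Contraction is projection along the span of a basis of `C`. -/
lemma IsRepresentable.contract {M : Matroid α} (hM : M.IsRepresentable F) (C : Set α) :
    (M ／ C).IsRepresentable F := by
  obtain ⟨n, w, hw⟩ := hM
  obtain ⟨I, hI⟩ := M.exists_isBasis' C
  refine isRepresentable_of_linearIndepOn
    ((Submodule.span F (w '' I)).mkQ ∘ w) fun J hJ ↦ ?_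
  rw [contract_ground, subset_sdiff] at hJ
  rw [((hw I hI.indep.subset_ground).1 hI.indep).quotient_iff_union
    (hJ.2.symm.mono_left hI.subset), hI.contract_indep_iff, and_iff_left hJ.2.symm, union_comm,
    hw _ (union_subset hI.indep.subset_ground hJ.1)]

lemma IsRepresentable.minor {M N : Matroid α} (hM : M.IsRepresentable F) (h : N.IsMinor M) :
    N.IsRepresentable F := by
  obtain ⟨C, D, rfl⟩ := h
  exact (hM.contract C).delete D

lemma IsRepresentable.sum {β : Type*} {M : Matroid α} {N : Matroid β}
    (hM : M.IsRepresentable F) (hN : N.IsRepresentable F) :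
    (M.sum N).IsRepresentable F := by
  obtain ⟨m, w, hw⟩ := hM
  obtain ⟨n, z, hz⟩ := hN
  let f := LinearMap.inl F (Fin m → F) (Fin n → F)
  let g := LinearMap.inr F (Fin m → F) (Fin n → F)
  have hf : LinearMap.ker f = ⊥ := LinearMap.ker_eq_bot.2 LinearMap.inl_injective
  have hg : LinearMap.ker g = ⊥ := LinearMap.ker_eq_bot.2 LinearMap.inr_injective
  refine isRepresentable_of_linearIndepOn
    (Sum.elim (f ∘ w) (g ∘ z) : α ⊕ β → (Fin m → F) × (Fin n → F)) fun I hI ↦ ?_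
  obtain ⟨A, B, rfl⟩ : ∃ A B, I = Sum.inl '' A ∪ Sum.inr '' B :=
    ⟨_, _, (image_preimage_inl_union_image_preimage_inr I).symm⟩
  simp only [sum_ground, union_subset_iff, image_subset_iff, preimage_union,
    preimage_image_eq _ Sum.inl_injective, preimage_image_eq _ Sum.inr_injective,
    preimage_inl_image_inr, preimage_inr_image_inl, union_empty, empty_union] at hI
  have hA : LinearIndepOn F (f ∘ w) A ↔ LinearIndepOn F w A :=
    LinearMap.linearIndependent_iff (v := fun x : A ↦ w x) f hf
  have hB : LinearIndepOn F (g ∘ z) B ↔ LinearIndepOn F z B :=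
    LinearMap.linearIndependent_iff (v := fun x : B ↦ z x) g hg
  rw [linearIndepOn_union_iff (by
      rw [disjoint_left]; rintro _ ⟨a, _, rfl⟩ ⟨b, _, h⟩; cases h),
    linearIndepOn_image Sum.inl_injective.injOn, linearIndepOn_image Sum.inr_injective.injOn,
    Sum.elim_comp_inl, Sum.elim_comp_inr, hA, hB, ← hw A hI.1, ← hz B hI.2, sum_indep_iff]
  simp only [preimage_union,
    preimage_image_eq _ Sum.inl_injective, preimage_image_eq _ Sum.inr_injective,
    preimage_inl_image_inr, preimage_inr_image_inl, union_empty, empty_union]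
  refine and_congr_right fun _ ↦ (and_iff_left ?_).symm
  rw [← image_comp, ← image_comp, Sum.elim_comp_inl, Sum.elim_comp_inr, image_comp, image_comp,
    Submodule.span_image, Submodule.span_image]
  exact (LinearMap.isCompl_range_inl_inr (R := F)).disjoint.mono
    LinearMap.map_le_range LinearMap.map_le_range

lemma isRepresentable_freeOn_univ [Finite α] : (freeOn (univ : Set α)).IsRepresentable F := by
  classical
  have := Fintype.ofFinite α
  refine isRepresentable_of_linearIndepOn (fun i ↦ (Pi.single i 1 : α → F)) fun I hI ↦ ?_
  have : LinearIndepOn F (fun i ↦ (Pi.single i 1 : α → F)) I :=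
    (Pi.linearIndependent_single_one α F).linearIndepOn I
  simpa using this

/-- Over an infinite field a space is not a finite union of proper subspaces. Hence the span of `X`
contains a vector outside the span of every independent set that does not span `X`, and this vector
represents `e`. -/
lemma IsRepresentable.principalExtension [Infinite F] {M M' : Matroid α} {X : Set α} {e : α}
    (hfin : M.Finite) (hM : M.IsRepresentable F) (h : M.IsPrincipalExtension M' X e) :
    M'.IsRepresentable F := by
  classical
  obtain ⟨n, w, hw⟩ := hM
  obtain ⟨x, hxX, hx⟩ : ∃ x ∈ Submodule.span F (w '' X), ∀ I, M.Indep I →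
      x ∈ Submodule.span F (w '' I) → X ⊆ M.closure I := by
    let P := Submodule.span F (w '' X)
    let s : Set (Submodule F P) := (fun I ↦ (Submodule.span F (w '' I)).comap P.subtype) ''
      {I | M.Indep I ∧ ¬ X ⊆ M.closure I}
    have hs : s.Finite := (hfin.ground_finite.finite_subsets.subset
      fun I hI ↦ hI.1.subset_ground).image _
    have htop : ⊤ ∉ s := by
      rintro ⟨I, ⟨hI, hXI⟩, h1⟩
      refine hXI fun y hy ↦ ?_
      rw [mem_closure_iff hw hI (h.isFlat.subset_ground hy)]
      exact Submodule.comap_subtype_eq_top.1 h1 (Submodule.subset_span ⟨y, hy, rfl⟩)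
    have := Subspace.biUnion_ne_univ_of_top_notMem (s := hs.toFinset) (by simpa using htop)
    obtain ⟨x, hx⟩ := (ne_univ_iff_exists_notMem _).1 this
    refine ⟨x, x.2, fun I hI hxI ↦ by_contra fun hc ↦ hx ?_⟩
    exact mem_biUnion (x := (Submodule.span F (w '' I)).comap P.subtype)
      (hs.mem_toFinset.2 ⟨I, ⟨hI, hc⟩, rfl⟩) hxI
  refine ⟨n, Function.update w e x, fun I hI ↦ ?_⟩
  have key : ∀ J ⊆ M.E, M'.Indep J ↔ LinearIndepOn F (Function.update w e x) J := fun J hJ ↦ by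
    have heJ : e ∉ J := fun h' ↦ h.notMem_ground (hJ h')
    rw [linearIndepOn_congr (w := w)
      (fun y hy ↦ Function.update_of_ne (ne_of_mem_of_not_mem hy heJ) _ _), ← hw J hJ,
      ← h.delete_eq, delete_indep_iff, and_iff_left (disjoint_singleton_right.2 heJ)]
  rw [h.ground_eq] at hI
  by_cases heI : e ∈ I
  · obtain ⟨J, heJ, rfl⟩ : ∃ J, e ∉ J ∧ I = insert e J :=
      ⟨I \ {e}, by simp, by simp [insert_eq_of_mem heI]⟩
    have hJ : J ⊆ M.E := fun y hy ↦ (hI (mem_insert_of_mem _ hy)).resolve_left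
      (ne_of_mem_of_not_mem hy heJ)
    rw [linearIndepOn_insert heJ, ← key J hJ, Function.update_self, insert_indep_iff]
    refine and_congr_right fun hJi ↦ ?_
    have hJM : M.Indep J := (hw J hJ).2 <| by
      rwa [key J hJ, linearIndepOn_congr (w := w)
        (fun y hy ↦ Function.update_of_ne (ne_of_mem_of_not_mem hy heJ) _ _)] at hJi
    have h1 : Function.update w e x '' J = w '' J :=
      image_congr fun y hy ↦ Function.update_of_ne (ne_of_mem_of_not_mem hy heJ) _ _
    rw [h1]
    simp only [heJ, not_false_eq_true, forall_const, mem_sdiff, h.ground_eq, mem_insert_iff,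
      true_or, true_and, h.mem_closure_iff J hJ]
    refine not_congr ⟨fun h2 ↦ ?_, hx J hJM⟩
    refine Submodule.span_le.2 ?_ hxX
    rintro _ ⟨y, hy, rfl⟩
    exact (mem_closure_iff hw hJM (h.isFlat.subset_ground hy)).1 (h2 hy)
  · exact key I fun y hy ↦ (hI hy).resolve_left (ne_of_mem_of_not_mem hy heI)

end Representable

end Matroid

/-! ### Classes closed under the construction -/

open Matroid

/-- Closure of a class under the operations used in the construction below; natural classes
that contain the free matroids and the class of representable matroids have this property. -/
structure MatroidClass.IsExtensionClosed (𝓜 : MatroidClass.{u}) : Prop where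
  isomorphic : ∀ (α β : Type u) (M : Matroid α) (N : Matroid β),
    𝓜 α M → M.IsIsomorphic N → 𝓜 β N
  minor : ∀ (α : Type u) (M N : Matroid α), 𝓜 α M → N.IsMinor M → 𝓜 α N
  principalExtension : ∀ (α : Type u) (M M' : Matroid α) (F : Set α) (e : α),
    𝓜 α M → M.IsPrincipalExtension M' F e → 𝓜 α M'
  directSum : ∀ (α β : Type u) (M : Matroid α) (N : Matroid β),
    𝓜 α M → 𝓜 β N → 𝓜 (α ⊕ β) (M.sum N)
  free : ∀ (α : Type u) [Finite α], 𝓜 α (freeOn univ)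

/-- The class of finite `F`-representable matroids. -/
def MatroidClass.representable (F : Type v) [Field F] : MatroidClass.{u} :=
  fun _ M ↦ M.Finite ∧ M.IsRepresentable F

lemma Matroid.IsIsomorphic.finite {α : Type*} {β : Type*} {M : Matroid α} {N : Matroid β}
    (h : M.IsIsomorphic N) (hM : M.Finite) : N.Finite := by
  obtain ⟨e, _⟩ := h
  have := hM.ground_finite.to_subtype
  have := Finite.of_equiv _ e
  exact ⟨N.E.toFinite⟩

/-- The constructions below are stated for every extension-closed class. Used with `𝓜` they give
membership of the gadget; used with this class they show that the gadget of a representable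
extension is representable. -/
lemma MatroidClass.isExtensionClosed_representable (F : Type v) [Field F] [Infinite F] :
    (MatroidClass.representable.{u} F).IsExtensionClosed where
  isomorphic _ _ _ _ hM h := ⟨h.finite hM.1, hM.2.of_isIsomorphic h⟩
  minor _ _ _ hM h := ⟨⟨hM.1.ground_finite.subset h.subset⟩, hM.2.minor h⟩
  principalExtension _ _ _ _ _ hM h :=
    ⟨⟨h.ground_eq ▸ hM.1.ground_finite.insert _⟩, hM.2.principalExtension hM.1 h⟩
  directSum _ _ _ _ hM hN :=
    ⟨⟨by rw [sum_ground]; exact (hM.1.ground_finite.image _).union (hN.1.ground_finite.image _)⟩,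
      hM.2.sum hN.2⟩
  free _ := ⟨finite_of_finite, isRepresentable_freeOn_univ⟩

lemma MatroidClass.IsNatural.isExtensionClosed {F : Type v} [Field F] {𝓜 : MatroidClass.{u}}
    (h : 𝓜.IsNatural) (hF : 𝓜.ProperlyContainsRepresentable F) : 𝓜.IsExtensionClosed where
  isomorphic := h.isomorphic
  minor := h.minor
  principalExtension := h.principalExtension
  directSum := h.directSum
  free _ := hF.1 _ _ finite_of_finite isRepresentable_freeOn_univ

lemma MatroidClass.IsExtensionClosed.comap {𝓜 : MatroidClass.{u}} (h : 𝓜.IsExtensionClosed)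
    {α β : Type u} {M : Matroid β} (hM : 𝓜 β M) {f : α → β} (hf : Function.Injective f) :
    𝓜 α (M.comap f) :=
  h.isomorphic _ _ _ _ (h.minor _ _ _ hM ⟨∅, M.E \ (range f ∩ M.E), by
    rw [contract_empty, delete_compl inter_subset_right]⟩) (comap_isIsomorphic_restrict hf).symm

namespace Matroid

/-! ### Principal extensions by one element -/

section PrincipalExtension

variable {γ : Type*} [Finite γ] {M : Matroid γ}

lemma Indep.ncard_le_rk {I X : Set γ} (hI : M.Indep I) (hIX : I ⊆ X) : I.ncard ≤ M.rk X :=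
  (indep_iff_rk.1 hI).symm.le.trans (rk_mono hIX)

lemma rk_union_eq_of_rk_eq {X Y : Set γ} (h : X ⊆ Y) (hr : M.rk X = M.rk Y) (Z : Set γ) :
    M.rk (X ∪ Z) = M.rk (Y ∪ Z) := by
  refine le_antisymm (rk_mono (union_subset_union_left _ h)) ?_
  have h1 := M.rk_inter_add_rk_union_le Y (X ∪ Z)
  have h2 : M.rk X ≤ M.rk (Y ∩ (X ∪ Z)) := rk_mono (subset_inter h subset_union_left)
  have h3 : M.rk (Y ∪ Z) ≤ M.rk (Y ∪ (X ∪ Z)) := rk_mono (by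
    rintro x (hx | hx) <;> simp [hx])
  omega

lemma subset_closure_iff_rk {X Y : Set γ} (hX : X ⊆ M.E) :
    X ⊆ M.closure Y ↔ M.rk (Y ∪ X) = M.rk Y := by
  constructor
  · intro h
    exact rk_union_eq_of_forall M fun y hy ↦ (mem_closure_iff_rk (hX hy)).1 (h hy)
  · intro h x hx
    rw [mem_closure_iff_rk (hX hx)]
    refine le_antisymm (h ▸ rk_mono ?_) (rk_mono (subset_insert _ _))
    exact insert_subset (Or.inr hx) subset_union_left

lemma exists_rk_insert_of_rk_lt {I J : Set γ} (hI : M.Indep I) (h : M.rk I < M.rk (I ∪ J)) :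
    ∃ x ∈ J \ I, M.Indep (insert x I) := by
  by_contra! hc
  refine h.ne' (rk_union_eq_of_forall M fun y hy ↦ ?_)
  by_cases hyI : y ∈ I
  · rw [insert_eq_of_mem hyI]
  have h1 := hc y ⟨hy, hyI⟩
  rw [indep_iff_rk, ncard_insert_of_notMem hyI, ← indep_iff_rk.1 hI] at h1
  have h2 := M.rk_insert_le y I
  have h3 : M.rk I ≤ M.rk (insert y I) := rk_mono (subset_insert y I)
  omega

variable (M) in
/-- The matroid obtained by adding `e` freely to the closure of `X`. -/
def freeExtension (X : Set γ) (e : γ) : Matroid γ :=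
  (IndepMatroid.ofFinite (E := insert e M.E) (toFinite _)
    (fun I ↦ M.Indep (I \ {e}) ∧ (e ∈ I → M.rk (I \ {e}) < M.rk (I \ {e} ∪ X)))
    (by simp)
    (by
      rintro I J ⟨hJ, hJe⟩ hIJ
      refine ⟨hJ.subset (sdiff_subset_sdiff_left hIJ), fun heI ↦ ?_⟩
      by_contra hc
      -- If `I \ {e}` spanned `X`, so would the larger set `J \ {e}`.
      have h1 : M.rk (I \ {e}) = M.rk (I \ {e} ∪ X) :=
        le_antisymm (rk_mono subset_union_left) (not_lt.1 hc)
      have h2 := rk_union_eq_of_rk_eq subset_union_left h1 (J \ {e})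
      rw [union_right_comm, union_eq_self_of_subset_left (sdiff_subset_sdiff_left hIJ)] at h2
      exact (hJe (hIJ heI)).ne h2)
    (by
      rintro I J ⟨hI, hIe⟩ ⟨hJ, hJe⟩ hlt
      have cI : e ∈ I → I.ncard = (I \ {e}).ncard + 1 :=
        fun h ↦ (ncard_sdiff_singleton_add_one h).symm
      have cI' : e ∉ I → I.ncard = (I \ {e}).ncard := fun h ↦ by rw [sdiff_singleton_eq_self h]
      have cJ : e ∈ J → J.ncard = (J \ {e}).ncard + 1 :=
        fun h ↦ (ncard_sdiff_singleton_add_one h).symm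
      have cJ' : e ∉ J → J.ncard = (J \ {e}).ncard := fun h ↦ by rw [sdiff_singleton_eq_self h]
      set I₀ := I \ {e} with hI₀
      set J₀ := J \ {e} with hJ₀
      have rI := indep_iff_rk.1 hI
      have rJ := indep_iff_rk.1 hJ
      have hsw : ∀ x ∈ J₀ \ I₀, x ∈ J ∧ x ∉ I ∧ insert x I \ {e} = insert x I₀ := by
        rintro x ⟨⟨hxJ, hxe⟩, hxI⟩
        refine ⟨hxJ, fun h ↦ hxI ⟨h, hxe⟩, ?_⟩
        rw [hI₀, insert_sdiff_of_notMem _ hxe]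
      have hmono : M.rk J₀ ≤ M.rk (I₀ ∪ J₀) := rk_mono subset_union_right
      by_cases heI : e ∈ I
      -- If nothing can be added, then each `x ∈ J₀` that extends `I₀` independently makes it span
      -- `X`. For `f ∈ X` outside the closure of `I₀`, exchange puts all of `J₀ ∪ X` into the
      -- closure of `insert f I₀`, whose rank `|I₀| + 1` is too small for `|I| < |J|`.
      · by_contra! hc
        have hF : ∀ x ∈ J₀ \ I₀, M.Indep (insert x I₀) →
            M.rk (insert x I₀ ∪ X) = M.rk (insert x I₀) := by
          intro x hx hxi
          obtain ⟨hxJ, hxI, hins⟩ := hsw x hx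
          have := hc x hxJ hxI
          rw [hins] at this
          exact le_antisymm (this hxi).2 (rk_mono subset_union_left)
        obtain ⟨f, hf, hfI⟩ : ∃ f ∈ X, M.rk (insert f I₀) ≠ M.rk I₀ := by
          by_contra! h
          exact (hIe heI).ne' (rk_union_eq_of_forall M h)
        have hlt' : M.rk I₀ < M.rk J₀ := by
          by_cases heJ : e ∈ J
          · have := cI heI; have := cJ heJ; omega
          · have := cI heI; have := cJ' heJ; omega
        have hf1 : M.rk (insert f I₀) = M.rk I₀ + 1 := by
          have := M.rk_insert_le f I₀
          have : M.rk I₀ ≤ M.rk (insert f I₀) := rk_mono (subset_insert _ _)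
          omega
        have hJf : ∀ y ∈ J₀ ∪ X, M.rk (insert y (insert f I₀)) = M.rk (insert f I₀) := by
          have hJf' : ∀ y ∈ J₀, M.rk (insert y (insert f I₀)) = M.rk (insert f I₀) := by
            intro y hy
            by_cases hyI : y ∈ I₀
            · rw [insert_eq_of_mem (mem_insert_of_mem _ hyI)]
            by_cases hyi : M.Indep (insert y I₀)
            · have h1 := hF y ⟨hy, hyI⟩ hyi
              have h2 : M.rk (insert y (insert f I₀)) ≤ M.rk (insert y I₀ ∪ X) :=
                rk_mono (by
                  rintro z (rfl | rfl | hz)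
                  · simp
                  · exact Or.inr hf
                  · simp [hz])
              have h3 := M.rk_insert_le y I₀
              have h4 : M.rk (insert f I₀) ≤ M.rk (insert y (insert f I₀)) :=
                rk_mono (subset_insert _ _)
              omega
            · have h3 := M.rk_insert_le y I₀
              have h4 : M.rk I₀ ≤ M.rk (insert y I₀) := rk_mono (subset_insert _ _)
              rw [indep_iff_rk, ncard_insert_of_notMem hyI] at hyi
              have h5 := rk_union_eq_of_rk_eq (subset_insert y I₀)
                (show M.rk I₀ = M.rk (insert y I₀) by omega) {f}
              rw [union_singleton, union_singleton, insert_comm] at h5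
              exact h5.symm
          obtain ⟨y, hy, hyi⟩ := exists_rk_insert_of_rk_lt hI (hlt'.trans_le hmono)
          have ry : M.rk (insert y I₀) = M.rk I₀ + 1 := by
            rw [indep_iff_rk.1 hyi, ncard_insert_of_notMem hy.2, rI]
          rintro z (hz | hz)
          · exact hJf' z hz
          · have h1 := hF y hy hyi
            have h2 : M.rk (insert z (insert f I₀)) ≤ M.rk (insert y I₀ ∪ X) := rk_mono (by
              rintro w (rfl | rfl | hw)
              · exact Or.inr hz
              · exact Or.inr hf
              · simp [hw])
            have h4 : M.rk (insert f I₀) ≤ M.rk (insert z (insert f I₀)) :=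
              rk_mono (subset_insert _ _)
            omega
        have hJX := rk_union_eq_of_forall M hJf
        have h6 : M.rk (J₀ ∪ X) ≤ M.rk (insert f I₀ ∪ (J₀ ∪ X)) := rk_mono subset_union_right
        have h7 : M.rk J₀ ≤ M.rk (J₀ ∪ X) := rk_mono subset_union_left
        by_cases heJ : e ∈ J
        · have := hJe heJ; have := cI heI; have := cJ heJ; omega
        · have := cI heI; have := cJ' heJ
          omega
      · by_cases hlt' : M.rk I₀ < M.rk (I₀ ∪ J₀)
        · obtain ⟨x, hx, hxi⟩ := exists_rk_insert_of_rk_lt hI hlt'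
          obtain ⟨hxJ, hxI, hins⟩ := hsw x hx
          refine ⟨x, hxJ, hxI, ?_, fun h ↦ ?_⟩
          · rwa [hins]
          · exact absurd h (by rintro (rfl | h); exacts [hx.1.2 rfl, heI h])
        · have heq : M.rk I₀ = M.rk (I₀ ∪ J₀) := le_antisymm (rk_mono subset_union_left)
            (not_lt.1 hlt')
          -- Now `I₀` spans `J₀`, so counting forces `e ∈ J` and `|J₀| = |I₀|`. The two sets have
          -- the same closure; as `J₀` does not span `X`, neither does `I₀`, and `e` can be added.
          have heJ : e ∈ J := by
            by_contra h
            have := cJ' h; have := cI' heI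
            omega
          have hrJ : M.rk J₀ = M.rk (I₀ ∪ J₀) := by
            have := cJ heJ; have := cI' heI
            omega
          have h1 := rk_union_eq_of_rk_eq subset_union_left heq X
          have h2 := rk_union_eq_of_rk_eq subset_union_right hrJ X
          have h3 : insert e I \ {e} = I₀ := by
            rw [hI₀, insert_sdiff_of_mem _ (mem_singleton e)]
          refine ⟨e, heJ, heI, by rwa [h3], fun _ ↦ ?_⟩
          rw [h3]
          have := hJe heJ
          omega)
    (by
      rintro I ⟨hI, -⟩ x hx
      by_cases hxe : x = e
      · exact Or.inl hxe
      · exact Or.inr (hI.subset_ground ⟨hx, hxe⟩))).matroid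

@[simp] lemma freeExtension_ground (X : Set γ) (e : γ) :
    (M.freeExtension X e).E = insert e M.E := rfl

lemma freeExtension_indep_iff {X : Set γ} {e : γ} {I : Set γ} :
    (M.freeExtension X e).Indep I ↔
      M.Indep (I \ {e}) ∧ (e ∈ I → M.rk (I \ {e}) < M.rk (I \ {e} ∪ X)) := by
  rw [freeExtension, IndepMatroid.matroid_indep_iff]
  rfl

lemma freeExtension_indep_iff_of_notMem {X : Set γ} {e : γ} {I : Set γ} (he : e ∉ I) :
    (M.freeExtension X e).Indep I ↔ M.Indep I := by
  rw [freeExtension_indep_iff, sdiff_singleton_eq_self he]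
  simp [he]

lemma rk_freeExtension_of_notMem (X : Set γ) {e : γ} {Y : Set γ} (he : e ∉ Y) :
    (M.freeExtension X e).rk Y = M.rk Y := by
  obtain ⟨I, hIY, hI, hI'⟩ := M.exists_indep_rk Y
  obtain ⟨J, hJY, hJ, hJ'⟩ := (M.freeExtension X e).exists_indep_rk Y
  have heI : e ∉ I := fun h ↦ he (hIY h)
  have heJ : e ∉ J := fun h ↦ he (hJY h)
  rw [freeExtension_indep_iff_of_notMem heJ] at hJ
  rw [← freeExtension_indep_iff_of_notMem (X := X) heI] at hI
  have := hI.ncard_le_rk hIY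
  have := hJ.ncard_le_rk hJY
  omega

/-- The second term is the smaller one only if `Y` already spans `X`, and then it is `M.rk Y`. -/
lemma rk_freeExtension_insert (X : Set γ) {e : γ} {Y : Set γ} (he : e ∉ Y) :
    (M.freeExtension X e).rk (insert e Y) = min (M.rk Y + 1) (M.rk (Y ∪ X)) := by
  set N := M.freeExtension X e with hN
  have h1 : N.rk Y = M.rk Y := rk_freeExtension_of_notMem X he
  have h2 : N.rk (insert e Y) ≤ N.rk Y + 1 := N.rk_insert_le e Y
  have h3 : M.rk Y ≤ M.rk (Y ∪ X) := rk_mono subset_union_left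
  have h4 : N.rk Y ≤ N.rk (insert e Y) := rk_mono (subset_insert e Y)
  have h5 : M.rk Y < M.rk (Y ∪ X) → M.rk Y + 1 ≤ N.rk (insert e Y) := fun h ↦ by
    obtain ⟨I, hIY, hI, hI'⟩ := M.exists_indep_rk Y
    have heI : e ∉ I := fun h ↦ he (hIY h)
    have := rk_union_eq_of_rk_eq hIY ((indep_iff_rk.1 hI).trans hI') X
    have hIn : N.Indep (insert e I) := by
      rw [hN, freeExtension_indep_iff, insert_sdiff_of_mem _ (mem_singleton e),
        sdiff_singleton_eq_self heI]
      refine ⟨hI, fun _ ↦ ?_⟩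
      have := indep_iff_rk.1 hI
      omega
    have := hIn.ncard_le_rk (insert_subset_insert hIY)
    rw [ncard_insert_of_notMem heI] at this
    omega
  have h6 : N.rk (insert e Y) = M.rk Y + 1 → M.rk Y < M.rk (Y ∪ X) := fun h ↦ by
    obtain ⟨J, hJY, hJ, hJ'⟩ := N.exists_indep_rk (insert e Y)
    have hJY' : J \ {e} ⊆ Y := by
      rintro x ⟨hx, hxe⟩
      exact (hJY hx).resolve_left hxe
    rw [hN, freeExtension_indep_iff] at hJ
    have h7 := hJ.1.ncard_le_rk hJY'
    by_cases heJ : e ∈ J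
    · have h8 := hJ.2 heJ
      have h9 := ncard_sdiff_singleton_add_one heJ
      have h10 := indep_iff_rk.1 hJ.1
      have := rk_union_eq_of_rk_eq hJY' (show M.rk (J \ {e}) = M.rk Y by omega) X
      omega
    · rw [sdiff_singleton_eq_self heJ] at h7
      omega
  omega

lemma isPrincipalExtension_freeExtension {X : Set γ} (hX : X ⊆ M.E) {e : γ} (he : e ∉ M.E) :
    M.IsPrincipalExtension (M.freeExtension X e) (M.closure X) e where
  isFlat := M.isFlat_closure X
  notMem_ground := he
  ground_eq := rfl
  delete_eq := by
    refine ext_indep (by simp [he]) fun I hI ↦ ?_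
    have heI : e ∉ I := fun h ↦ by simpa using hI h
    rw [delete_indep_iff, freeExtension_indep_iff_of_notMem heI]
    simp [heI]
  mem_closure_iff Y hY := by
    have heY : e ∉ Y := fun h ↦ he (hY h)
    rw [mem_closure_iff_rk (mem_insert _ _), rk_freeExtension_insert X heY,
      rk_freeExtension_of_notMem X heY,
      show M.closure X ⊆ M.closure Y ↔ X ⊆ M.closure Y from
        ⟨(M.subset_closure X).trans, M.closure_subset_closure_of_subset_closure⟩,
      subset_closure_iff_rk hX]
    have h3 : M.rk Y ≤ M.rk (Y ∪ X) := rk_mono subset_union_left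
    omega

end PrincipalExtension

/-! ### Simultaneous principal extensions and their rank formula -/

section FreeExtensions

/-- Each new element of `Q` either counts as one dimension or is traded for its whole flat; `P` is
the set of traded ones. The flats lie in the old ground set, so the elements can be added one at a
time: the two terms of `rk_freeExtension_insert` are the cases `e ∉ P` and `e ∈ P`, the latter using
the induction hypothesis at `Y ∪ f e`. -/
lemma exists_freeExtension_aux {γ : Type u} [Finite γ] {M : Matroid γ} {f : γ → Set γ}
    (hf : ∀ j, f j ⊆ M.E) (J : Set γ) (hJ : Disjoint J M.E) :
    ∃ M' : Matroid γ, M'.E = J ∪ M.E ∧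
      (∀ 𝓒 : MatroidClass.{u}, 𝓒.IsExtensionClosed → 𝓒 γ M → 𝓒 γ M') ∧
      ∀ Y Q, Disjoint Y J → Q ⊆ J →
        (∀ P ⊆ Q, M'.rk (Y ∪ Q) ≤ M.rk (Y ∪ ⋃ j ∈ P, f j) + (Q \ P).ncard) ∧
        ∃ P ⊆ Q, M'.rk (Y ∪ Q) = M.rk (Y ∪ ⋃ j ∈ P, f j) + (Q \ P).ncard := by
  induction J, J.toFinite using Set.Finite.induction_on with
  | empty =>
    refine ⟨M, by simp, fun _ _ h ↦ h, fun Y Q _ hQ ↦ ?_⟩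
    obtain rfl := subset_empty_iff.1 hQ
    refine ⟨fun P hP ↦ ?_, ∅, by simp⟩
    obtain rfl := subset_empty_iff.1 hP
    simp
  | @insert e J heJ _ ih =>
    have hJ' : Disjoint J M.E := hJ.mono_left (subset_insert _ _)
    have heE : e ∉ M.E := fun h ↦ disjoint_left.1 hJ (mem_insert _ _) h
    obtain ⟨N, hNE, hNC, hNr⟩ := ih hJ'
    have hfN : f e ⊆ N.E := (hf e).trans (hNE ▸ subset_union_right)
    have heN : e ∉ N.E := by rw [hNE]; simp [heJ, heE]
    have hext := isPrincipalExtension_freeExtension hfN heN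
    refine ⟨N.freeExtension (f e) e, by rw [freeExtension_ground, hNE, insert_union],
      fun 𝓒 h𝓒 hM ↦ h𝓒.principalExtension _ _ _ _ _ (hNC 𝓒 h𝓒 hM) hext, fun Y Q hY hQ ↦ ?_⟩
    have heY : e ∉ Y := fun h ↦ disjoint_left.1 hY h (mem_insert _ _)
    have hYJ : Disjoint Y J := hY.mono_right (subset_insert _ _)
    by_cases heQ : e ∈ Q
    · obtain ⟨R, heR, rfl⟩ : ∃ R, e ∉ R ∧ Q = insert e R :=
        ⟨Q \ {e}, by simp, by simp [insert_eq_of_mem heQ]⟩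
      have hRJ : R ⊆ J := fun x hx ↦ (hQ (mem_insert_of_mem _ hx)).resolve_left
        (ne_of_mem_of_not_mem hx heR)
      have hYf : Disjoint (Y ∪ f e) J := hYJ.union_left (hJ'.symm.mono_left (hf e))
      have h1 := hNr Y R hYJ hRJ
      have h2 := hNr (Y ∪ f e) R hYf hRJ
      rw [union_insert, rk_freeExtension_insert _ (by simp [heY, heR]),
        show Y ∪ R ∪ f e = (Y ∪ f e) ∪ R from union_right_comm _ _ _]
      have hne : ∀ P ⊆ R, (insert e R \ P).ncard = (R \ P).ncard + 1 := fun P hP ↦ by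
        rw [insert_sdiff_of_notMem _ (fun h ↦ heR (hP h)), ncard_insert_of_notMem (by simp [heR])]
      have he : ∀ P ⊆ R, (insert e R \ insert e P).ncard = (R \ P).ncard := fun P hP ↦ by
        congr 1; ext x; simp only [mem_sdiff, mem_insert_iff]
        constructor
        · rintro ⟨rfl | h, h'⟩
          · simp at h'
          · exact ⟨h, fun h'' ↦ h' (Or.inr h'')⟩
        · rintro ⟨h, h'⟩
          exact ⟨Or.inr h, by rintro (rfl | h''); exacts [heR h, h' h'']⟩
      have hU : ∀ P, Y ∪ ⋃ j ∈ insert e P, f j = (Y ∪ f e) ∪ ⋃ j ∈ P, f j := fun P ↦ by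
        rw [biUnion_insert, union_assoc]
      constructor
      · intro P hP
        by_cases heP : e ∈ P
        · obtain ⟨P, heP', rfl⟩ : ∃ R, e ∉ R ∧ P = insert e R :=
            ⟨P \ {e}, by simp, by simp [insert_eq_of_mem heP]⟩
          have hPR : P ⊆ R := fun x hx ↦ (hP (mem_insert_of_mem _ hx)).resolve_left
            (ne_of_mem_of_not_mem hx heP')
          rw [he P hPR, hU]
          exact (min_le_right _ _).trans (h2.1 P hPR)
        · have hPR : P ⊆ R := fun x hx ↦ (hP hx).resolve_left (ne_of_mem_of_not_mem hx heP)
          rw [hne P hPR, ← add_assoc]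
          exact (min_le_left _ _).trans (Nat.add_le_add_right (h1.1 P hPR) 1)
      · rcases min_choice (N.rk (Y ∪ R) + 1) (N.rk (Y ∪ f e ∪ R)) with h | h
        · obtain ⟨P, hP, hPr⟩ := h1.2
          exact ⟨P, hP.trans (subset_insert _ _), by rw [h, hne P hP, hPr, add_assoc]⟩
        · obtain ⟨P, hP, hPr⟩ := h2.2
          exact ⟨insert e P, insert_subset_insert hP, by rw [h, he P hP, hPr, hU]⟩
    · have hQJ : Q ⊆ J := fun x hx ↦ (hQ hx).resolve_left (ne_of_mem_of_not_mem hx heQ)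
      rw [rk_freeExtension_of_notMem _ (by simp [heY, heQ])]
      exact hNr Y Q hYJ hQJ

lemma rk_comap {γ δ : Type*} [Finite γ] [Finite δ] (M : Matroid δ) (f : γ → δ) (X : Set γ) :
    (M.comap f).rk X = M.rk (f '' X) := by
  rw [rk, eRk_comap, rk]

lemma rk_map_image {γ δ : Type*} [Finite γ] [Finite δ] (M : Matroid γ) {f : γ → δ}
    (hf : Function.Injective f) (X : Set γ) : (M.map f hf.injOn).rk (f '' X) = M.rk X := by
  rw [← rk_comap, comap_map hf]

lemma exists_freeExtension {γ κ : Type u} [Finite γ] [Finite κ] {M : Matroid γ}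
    (hM : M.E = univ) (f : κ → Set γ) :
    ∃ M' : Matroid (γ ⊕ κ), M'.E = univ ∧
      (∀ 𝓒 : MatroidClass.{u}, 𝓒.IsExtensionClosed → 𝓒 γ M → 𝓒 _ M') ∧
      ∀ (Y : Set γ) (Q : Set κ),
        (∀ P ⊆ Q, M'.rk (Sum.inl '' Y ∪ Sum.inr '' Q) ≤
          M.rk (Y ∪ ⋃ j ∈ P, f j) + (Q \ P).ncard) ∧
        ∃ P ⊆ Q, M'.rk (Sum.inl '' Y ∪ Sum.inr '' Q) =
          M.rk (Y ∪ ⋃ j ∈ P, f j) + (Q \ P).ncard := by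
  have hinj : Function.Injective (Sum.inl : γ → γ ⊕ κ) := Sum.inl_injective
  set N := M.map Sum.inl hinj.injOn with hN
  have hNE : N.E = range Sum.inl := by rw [hN, map_ground, hM, image_univ]
  have hC : ∀ 𝓒 : MatroidClass.{u}, 𝓒.IsExtensionClosed → 𝓒 γ M → 𝓒 _ N := fun 𝓒 h𝓒 h ↦ by
    have h1 := comap_isIsomorphic_restrict (N := N) hinj
    rw [hNE, inter_self, ← hNE, restrict_ground_eq_self, hN, comap_map hinj] at h1
    exact h𝓒.isomorphic _ _ _ _ h h1
  obtain ⟨M', hE, hC', hr⟩ := exists_freeExtension_aux (M := N)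
    (f := fun x ↦ Sum.elim (fun _ ↦ ∅) (fun j ↦ Sum.inl '' f j) x)
    (by rintro (x | x); · simp
        · rw [hNE]; exact image_subset_range _ _)
    (range Sum.inr) (by rw [hNE]; exact isCompl_range_inl_range_inr.disjoint.symm)
  refine ⟨M', by rw [hE, hNE, union_comm, range_inl_union_range_inr],
    fun 𝓒 h h' ↦ hC' 𝓒 h (hC 𝓒 h h'), fun Y Q ↦ ?_⟩
  have h1 := hr (Sum.inl '' Y) (Sum.inr '' Q)
    (isCompl_range_inl_range_inr.disjoint.mono_left (image_subset_range _ _))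
    (image_subset_range _ _)
  have h2 : ∀ P : Set κ, N.rk (Sum.inl '' Y ∪ ⋃ j ∈ (Sum.inr '' P : Set (γ ⊕ κ)),
      Sum.elim (fun _ ↦ ∅) (fun j ↦ Sum.inl '' f j) j) = M.rk (Y ∪ ⋃ j ∈ P, f j) := fun P ↦ by
    rw [biUnion_image, ← rk_map_image M hinj, image_union, image_iUnion₂]
    rfl
  have h3 : ∀ P : Set κ, ((Sum.inr '' Q : Set (γ ⊕ κ)) \ Sum.inr '' P).ncard = (Q \ P).ncard :=
    fun P ↦ by
      rw [← image_sdiff Sum.inr_injective, ncard_image_of_injective _ Sum.inr_injective]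
  constructor
  · intro P hP
    rw [← h2, ← h3]
    exact h1.1 _ (image_mono hP)
  · obtain ⟨P, hP, h⟩ := h1.2
    obtain ⟨P, hPQ, rfl⟩ := subset_image_iff.1 hP
    exact ⟨P, hPQ, by rw [h, h2, h3]⟩

end FreeExtensions
-- Construction of the gadget
section Gadget

lemma rk_sum {α β : Type*} [Finite α] [Finite β] (M : Matroid α) (N : Matroid β) (A : Set α)
    (B : Set β) : (M.sum N).rk (Sum.inl '' A ∪ Sum.inr '' B) = M.rk A + N.rk B := by
  have hpre : ∀ (I : Set α) (J : Set β), Sum.inl ⁻¹' (Sum.inl '' I ∪ Sum.inr '' J) = I ∧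
      Sum.inr ⁻¹' (Sum.inl '' I ∪ Sum.inr '' J) = J := fun I J ↦ by
    simp [preimage_image_eq _ Sum.inl_injective, preimage_image_eq _ Sum.inr_injective]
  have hcard : ∀ (I : Set α) (J : Set β),
      (Sum.inl '' I ∪ Sum.inr '' J : Set (α ⊕ β)).ncard = I.ncard + J.ncard := fun I J ↦ by
    rw [ncard_union_eq (by rw [disjoint_left]; rintro _ ⟨a, _, rfl⟩ ⟨b, _, h⟩; cases h),
      ncard_image_of_injective _ Sum.inl_injective, ncard_image_of_injective _ Sum.inr_injective]
  apply le_antisymm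
  · obtain ⟨I, hI, hIi, hIr⟩ := (M.sum N).exists_indep_rk (Sum.inl '' A ∪ Sum.inr '' B)
    obtain ⟨I, J, rfl⟩ : ∃ A B, I = Sum.inl '' A ∪ Sum.inr '' B :=
      ⟨_, _, (image_preimage_inl_union_image_preimage_inr I).symm⟩
    rw [sum_indep_iff, (hpre I J).1, (hpre I J).2] at hIi
    have h1 : I ⊆ A := by rw [← (hpre I J).1, ← (hpre A B).1]; exact preimage_mono hI
    have h2 : J ⊆ B := by rw [← (hpre I J).2, ← (hpre A B).2]; exact preimage_mono hI
    rw [← hIr, hcard]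
    exact Nat.add_le_add (hIi.1.ncard_le_rk h1) (hIi.2.ncard_le_rk h2)
  · obtain ⟨I, hI, hIi, hIr⟩ := M.exists_indep_rk A
    obtain ⟨J, hJ, hJi, hJr⟩ := N.exists_indep_rk B
    rw [← hIr, ← hJr, ← hcard]
    refine Indep.ncard_le_rk ?_ (union_subset_union (image_mono hI) (image_mono hJ))
    rw [sum_indep_iff, (hpre I J).1, (hpre I J).2]
    exact ⟨hIi, hJi⟩

lemma rk_freeOn_univ {α : Type*} [Finite α] (X : Set α) : (freeOn univ).rk X = X.ncard :=
  indep_iff_rk.1 (by simp)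

/-- The least value of `f` on the subsets of `Q`. -/
noncomputable def minOver {κ : Type*} (Q : Set κ) (f : Set κ → ℕ) : ℕ := sInf (f '' 𝒫 Q)

section minOver

variable {κ : Type*} {P Q : Set κ} {f : Set κ → ℕ} {n : ℕ}

lemma minOver_le (h : P ⊆ Q) : minOver Q f ≤ f P := Nat.sInf_le ⟨P, h, rfl⟩

lemma exists_minOver_eq (Q : Set κ) (f : Set κ → ℕ) : ∃ P ⊆ Q, minOver Q f = f P := by
  obtain ⟨P, hP, h⟩ := Nat.sInf_mem (s := f '' 𝒫 Q) ⟨_, ∅, empty_subset _, rfl⟩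
  exact ⟨P, hP, h.symm⟩

lemma eq_minOver (h : ∀ P ⊆ Q, n ≤ f P) (h' : ∃ P ⊆ Q, f P ≤ n) : n = minOver Q f := by
  obtain ⟨P, hP, h1⟩ := h'
  obtain ⟨R, hR, h2⟩ := exists_minOver_eq Q f
  exact le_antisymm (h2 ▸ h R hR) ((minOver_le hP).trans h1)

lemma le_minOver (h : ∀ P ⊆ Q, n ≤ f P) : n ≤ minOver Q f := by
  obtain ⟨R, hR, h2⟩ := exists_minOver_eq Q f
  exact h2 ▸ h R hR

end minOver

variable {α ι κ : Type*}

/-- The rank of the union of `X`, a set `I` of coloops indexed by `Option ι` and a set `B` of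
elements, the one indexed by `i` being placed freely on the line spanned by `z i` and the coloop
`some i`, in terms of the rank function `q` on the subsets of `α`. -/
noncomputable def frameRk (q : Set α → ℕ) (z : ι → α) (X : Set α) (I : Set (Option ι))
    (B : Set ι) : ℕ :=
  minOver B fun B' ↦ q (X ∪ z '' B') + (I ∪ some '' B').ncard + (B \ B').ncard

/-- The rank function of the gadget on the sets which consist of `frameRk`-type sets and a set `Q`
of elements, the one indexed by `y` being placed freely on the flat spanned by `y`, the
elements of `b y` and a further element that is free in the span of the coloops and the new
element of the extension whose rank function is `q'`. -/
noncomputable def gadgetRk (q q' : Set α → ℕ) (z : ι → α) (b : κ → Set ι) (t : Set κ → ℕ)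
    (X : Set α) (I : Set (Option ι)) (B : Set ι) (Q : Set κ) : ℕ :=
  open scoped Classical in
  minOver Q fun P ↦ (if P = ∅ then frameRk q z X I B else
    min (frameRk q z X I (B ∪ ⋃ y ∈ P, b y) + 1)
      (Nat.card (Option ι) + q' (X ∪ z '' (B ∪ ⋃ y ∈ P, b y)))) + t P + (Q \ P).ncard

/-- The rank of the subsets of `α` in a matroid on `α ⊕ Unit`. -/
noncomputable def baseRk (K : Matroid (α ⊕ Unit)) (X : Set α) : ℕ := K.rk (Sum.inl '' X)

/-- The rank of the sets `X ∪ {e}` with `X ⊆ α` in a matroid on `α ∪ {e}`. -/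
noncomputable def extRk (K : Matroid (α ⊕ Unit)) (X : Set α) : ℕ :=
  K.rk (insert (Sum.inr ()) (Sum.inl '' X))

/-- The subset of the ground set of the frame with the given three parts. -/
abbrev frameSet (X : Set α) (I : Set (Option ι)) (B : Set ι) : Set ((α ⊕ Option ι) ⊕ ι) :=
  Sum.inl '' (Sum.inl '' X ∪ Sum.inr '' I) ∪ Sum.inr '' B

lemma extRk_mono [Finite α] (K : Matroid (α ⊕ Unit)) {X Y : Set α} (h : X ⊆ Y) :
    extRk K X ≤ extRk K Y := rk_mono (insert_subset_insert (image_mono h))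

lemma baseRk_mono [Finite α] (K : Matroid (α ⊕ Unit)) {X Y : Set α} (h : X ⊆ Y) :
    baseRk K X ≤ baseRk K Y := rk_mono (image_mono h)

lemma extRk_union_le [Finite α] (K : Matroid (α ⊕ Unit)) (X Y : Set α) :
    extRk K (X ∪ Y) ≤ extRk K X + Y.ncard := by
  have := K.rk_union_le_ncard (insert (Sum.inr ()) (Sum.inl '' X)) (Sum.inl '' Y)
  rwa [ncard_image_of_injective _ Sum.inl_injective, insert_union, ← image_union] at this

/-- The coloop `some i` serves the line of `i`, and the coloop `none` is a spare one. Among the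
elements added afterwards, `none` is the point `p`, free in the span of `e` and all coloops. The
final `comap` deletes `e`, which from then on is visible only through `p`. -/
lemma exists_frame {α ι : Type u} [Finite α] [Finite ι] {K : Matroid (α ⊕ Unit)}
    (hK : K.E = univ) (z : ι → α) :
    ∃ M : Matroid ((α ⊕ Option ι) ⊕ Option ι), M.E = univ ∧
      (∀ 𝓒 : MatroidClass.{u}, 𝓒.IsExtensionClosed → 𝓒 _ K → 𝓒 _ M) ∧
      ∀ X I B, M.rk (Sum.inl '' (Sum.inl '' X ∪ Sum.inr '' I) ∪ Sum.inr '' (some '' B)) =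
          frameRk (baseRk K) z X I B ∧
        M.rk (Sum.inl '' (Sum.inl '' X ∪ Sum.inr '' I) ∪ Sum.inr '' (insert none (some '' B))) =
          min (frameRk (baseRk K) z X I B + 1) (Nat.card (Option ι) + extRk K (X ∪ z '' B)) := by
  set M₁ := K.sum (freeOn (univ : Set (Option ι))) with hM₁
  have hM₁E : M₁.E = univ := by simp [hM₁, hK, range_inl_union_range_inr]
  let f : Option ι → Set ((α ⊕ Unit) ⊕ Option ι) := fun o ↦ o.elim
    (Sum.inl '' {Sum.inr ()} ∪ Sum.inr '' univ) fun i ↦ {Sum.inl (Sum.inl (z i)), Sum.inr (some i)}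
  obtain ⟨M₂, hM₂E, hM₂C, hM₂⟩ := exists_freeExtension hM₁E f
  let g : (α ⊕ Option ι) ⊕ Option ι → ((α ⊕ Unit) ⊕ Option ι) ⊕ Option ι :=
    Sum.map (Sum.map Sum.inl id) id
  have hg : Function.Injective g :=
    Function.Injective.sumMap (Function.Injective.sumMap Sum.inl_injective Function.injective_id)
      Function.injective_id
  have hgi : ∀ (X : Set α) (I : Set (Option ι)) (B : Set (Option ι)),
      g '' (Sum.inl '' (Sum.inl '' X ∪ Sum.inr '' I) ∪ Sum.inr '' B) =
        Sum.inl '' (Sum.inl '' (Sum.inl '' X) ∪ Sum.inr '' I) ∪ Sum.inr '' B := fun X I B ↦ by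
    simp only [image_union, image_image, g, Sum.map_inl, Sum.map_inr, id]
  have hsome : ∀ (X : Set α) (I : Set (Option ι)) (P : Set ι),
      M₁.rk (Sum.inl '' (Sum.inl '' X) ∪ Sum.inr '' I ∪ ⋃ j ∈ some '' P, f j) =
        baseRk K (X ∪ z '' P) + (I ∪ some '' P).ncard := fun X I P ↦ by
    have : (Sum.inl '' (Sum.inl '' X) ∪ Sum.inr '' I ∪ ⋃ j ∈ some '' P, f j) =
        Sum.inl '' (Sum.inl '' (X ∪ z '' P)) ∪ Sum.inr '' (I ∪ some '' P) := by
      rw [biUnion_image]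
      ext x
      simp only [f, Option.elim_some, mem_union, mem_iUnion, mem_image, mem_insert_iff,
        mem_singleton_iff, exists_prop]
      aesop
    rw [this, hM₁, rk_sum, rk_freeOn_univ, baseRk]
  have hnone : ∀ (X : Set α) (I : Set (Option ι)) (P : Set ι),
      M₁.rk (Sum.inl '' (Sum.inl '' X) ∪ Sum.inr '' I ∪ ⋃ j ∈ insert none (some '' P), f j) =
        Nat.card (Option ι) + extRk K (X ∪ z '' P) := fun X I P ↦ by
    have : (Sum.inl '' (Sum.inl '' X) ∪ Sum.inr '' I ∪ ⋃ j ∈ insert none (some '' P), f j) =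
        Sum.inl '' (insert (Sum.inr ()) (Sum.inl '' (X ∪ z '' P))) ∪ Sum.inr '' univ := by
      rw [biUnion_insert, biUnion_image]
      ext x
      simp only [f, Option.elim_some, Option.elim_none, mem_union, mem_iUnion, mem_image,
        mem_insert_iff, mem_singleton_iff, exists_prop]
      aesop
    rw [this, hM₁, rk_sum, rk_freeOn_univ, extRk, ncard_univ, add_comm]
  have hinj : Function.Injective (some : ι → Option ι) := Option.some_injective ι
  have hr : ∀ X I B,
      M₂.rk (Sum.inl '' (Sum.inl '' (Sum.inl '' X) ∪ Sum.inr '' I) ∪ Sum.inr '' (some '' B)) =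
        frameRk (baseRk K) z X I B := fun X I B ↦ by
    have h := hM₂ (Sum.inl '' (Sum.inl '' X) ∪ Sum.inr '' I) (some '' B)
    refine eq_minOver (fun P hP ↦ ?_) ?_
    · have := h.1 (some '' P) (image_mono hP)
      rwa [hsome, ← image_sdiff hinj, ncard_image_of_injective _ hinj] at this
    · obtain ⟨P, hP, hPr⟩ := h.2
      obtain ⟨P, hP', rfl⟩ := subset_image_iff.1 hP
      rw [hsome, ← image_sdiff hinj, ncard_image_of_injective _ hinj] at hPr
      exact ⟨P, hP', hPr.ge⟩
  refine ⟨M₂.comap g, by rw [comap_ground_eq, hM₂E, preimage_univ], fun 𝓒 h h' ↦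
    h.comap (hM₂C 𝓒 h (h.directSum _ _ _ _ h' (h.free _))) hg, fun X I B ↦ ⟨?_, ?_⟩⟩
  · rw [rk_comap, hgi, hr]
  · rw [rk_comap, hgi]
    set Y : Set ((α ⊕ Unit) ⊕ Option ι) := Sum.inl '' (Sum.inl '' X) ∪ Sum.inr '' I with hY
    have h := hM₂ Y (insert none (some '' B))
    have hne : ∀ P : Set ι, none ∉ some '' P := by simp
    apply le_antisymm
    · apply le_min
      · rw [← hr]
        rw [image_insert_eq, union_insert]
        exact rk_insert_le _ _ _
      · have := h.1 _ Subset.rfl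
        rwa [hnone, sdiff_self, ncard_empty, add_zero] at this
    · obtain ⟨P, hP, hPr⟩ := h.2
      rw [hPr]
      by_cases hnP : none ∈ P
      · obtain ⟨R, hRB, rfl⟩ : ∃ R ⊆ B, P = insert none (some '' R) := by
          refine ⟨some ⁻¹' P, fun x hx ↦ ?_, ?_⟩
          · simpa using hP hx
          · ext (_ | x) <;> simp [hnP]
        have hd : (insert none (some '' B) \ insert none (some '' R)).ncard = (B \ R).ncard := by
          rw [← ncard_image_of_injective _ hinj]
          congr 1
          ext (_ | x) <;> simp
        rw [hnone, hd]
        refine (min_le_right _ _).trans ?_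
        -- Once all coloops are present, trading an element of `B` costs at most the one dimension
        -- that it counts otherwise, so `R = B` is optimal.
        have h1 : X ∪ z '' B = (X ∪ z '' R) ∪ z '' (B \ R) := by
          rw [union_assoc, ← image_union, union_sdiff_cancel hRB]
        have h2 := extRk_union_le K (X ∪ z '' R) (z '' (B \ R))
        have h3 := ncard_image_le (f := z) (toFinite (B \ R))
        rw [h1]
        omega
      · obtain ⟨R, hRB, rfl⟩ : ∃ R ⊆ B, P = some '' R := by
          refine ⟨some ⁻¹' P, fun x hx ↦ ?_, ?_⟩
          · simpa using hP hx
          · ext (_ | x) <;> simp [hnP]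
        have hd : (insert none (some '' B) \ some '' R).ncard = (B \ R).ncard + 1 := by
          rw [insert_sdiff_of_notMem _ (hne R), ncard_insert_of_notMem (by simp),
            ← image_sdiff hinj, ncard_image_of_injective _ hinj]
        rw [hsome, hd, ← add_assoc]
        exact (min_le_left _ _).trans (Nat.add_le_add_right (minOver_le hRB) 1)

/-- The elements of `κ` occur twice: as those of `N` and as the new free elements. The final `comap`
keeps only the new ones and also deletes `p`. -/
lemma exists_gadget {α ι κ : Type u} [Finite α] [Finite ι] [Finite κ] {K : Matroid (α ⊕ Unit)}
    (hK : K.E = univ) {N : Matroid κ} (hN : N.E = univ) (z : ι → α) (b : κ → Set ι) :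
    ∃ M : Matroid (((α ⊕ Option ι) ⊕ ι) ⊕ κ), M.E = univ ∧
      (∀ 𝓒 : MatroidClass.{u}, 𝓒.IsExtensionClosed → 𝓒 _ K → 𝓒 _ N → 𝓒 _ M) ∧
      ∀ X I B Q, M.rk (Sum.inl '' (frameSet X I B) ∪ Sum.inr '' Q) =
        gadgetRk (baseRk K) (extRk K) z b N.rk X I B Q := by
  obtain ⟨M₂, hM₂E, hM₂C, hM₂⟩ := exists_frame hK z
  set M₃ := M₂.sum N with hM₃
  have hM₃E : M₃.E = univ := by simp [hM₃, hM₂E, hN, range_inl_union_range_inr]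
  obtain ⟨M₄, hM₄E, hM₄C, hM₄⟩ := exists_freeExtension hM₃E
    (fun y ↦ Sum.inl '' (Sum.inr '' (insert none (some '' (b y)))) ∪ Sum.inr '' {y})
  let g : ((α ⊕ Option ι) ⊕ ι) ⊕ κ → (((α ⊕ Option ι) ⊕ Option ι) ⊕ κ) ⊕ κ :=
    Sum.map (Sum.inl ∘ Sum.map id some) id
  have hg : Function.Injective g :=
    Function.Injective.sumMap (Sum.inl_injective.comp
      (Function.Injective.sumMap Function.injective_id (Option.some_injective _)))
      Function.injective_id
  refine ⟨M₄.comap g, by rw [comap_ground_eq, hM₄E, preimage_univ], fun 𝓒 h h' h'' ↦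
    h.comap (hM₄C 𝓒 h (h.directSum _ _ _ _ (hM₂C 𝓒 h h') h'')) hg, fun X I B Q ↦ ?_⟩
  have hgi : g '' (Sum.inl '' (frameSet X I B) ∪ Sum.inr '' Q) =
      Sum.inl '' (Sum.inl '' (Sum.inl '' (Sum.inl '' X ∪ Sum.inr '' I) ∪
        Sum.inr '' (some '' B))) ∪ Sum.inr '' Q := by
    simp only [image_union, image_image, g, Sum.map_inl, Sum.map_inr, id, Function.comp]
  rw [rk_comap, hgi]
  have key : ∀ P : Set κ, M₃.rk (Sum.inl '' (Sum.inl '' (Sum.inl '' X ∪ Sum.inr '' I) ∪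
        Sum.inr '' (some '' B)) ∪
      ⋃ y ∈ P, (Sum.inl '' (Sum.inr '' (insert none (some '' (b y)))) ∪ Sum.inr '' {y})) =
      (open scoped Classical in
      (if P = ∅ then frameRk (baseRk K) z X I B else
    min (frameRk (baseRk K) z X I (B ∪ ⋃ y ∈ P, b y) + 1)
      (Nat.card (Option ι) + extRk K (X ∪ z '' (B ∪ ⋃ y ∈ P, b y)))) + N.rk P) := fun P ↦ by
    split_ifs with hP
    · subst hP
      have := M₂.rk_sum N
      have := this (Sum.inl '' (Sum.inl '' X ∪ Sum.inr '' I) ∪ Sum.inr '' (some '' B)) ∅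
      rw [image_empty, union_empty] at this
      simp only [mem_empty_iff_false, iUnion_of_empty, iUnion_empty, union_empty]
      rw [this, (hM₂ X I B).1]
    -- Any element of `P` brings `p` along, whence the separate case `P = ∅` in `gadgetRk`.
    · obtain ⟨y₀, hy₀⟩ := nonempty_iff_ne_empty.2 hP
      rw [← (hM₂ X I _).2, ← rk_sum]
      congr 1
      ext x
      simp only [mem_union, mem_iUnion, mem_image, mem_insert_iff, mem_singleton_iff, exists_prop]
      rcases x with ((x | x | x) | x)
      · simp
      · simp only [Sum.inl.injEq, reduceCtorEq, and_false, exists_false, or_false, false_or,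
          exists_eq_right, Sum.inr.injEq, or_true]
        simpa using ⟨y₀, hy₀⟩
      · simp
      · simp
  have h := hM₄ (Sum.inl '' (Sum.inl '' (Sum.inl '' X ∪ Sum.inr '' I) ∪
        Sum.inr '' (some '' B))) Q
  refine eq_minOver (fun P hP ↦ ?_) ?_
  · rw [← key]
    exact h.1 P hP
  · obtain ⟨P, hP, hPr⟩ := h.2
    rw [key] at hPr
    exact ⟨P, hP, hPr.ge⟩

end Gadget
-- Ranks in the gadget
section GadgetRank

variable {α ι κ σ : Type*}

/-- `q'` is the rank function of the sets `X ∪ {e}` for an extension by an element `e`, of the same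
rank `r`, of the matroid with rank function `q`. -/
structure IsExtPair (q q' : Set α → ℕ) (r : ℕ) : Prop where
  mono : Monotone q
  mono' : Monotone q'
  le' : ∀ X, q X ≤ q' X
  le_succ : ∀ X, q' X ≤ q X + 1
  empty : q ∅ = 0
  rank_eq : q univ = r
  rank_eq' : q' univ = r

/-- The family `S` consists of distinct hyperplanes of the matroid of rank `r` with rank
function `q`. -/
structure IsHyperplaneFamily (q : Set α → ℕ) (r : ℕ) (S : σ → Set α) : Prop where
  succ : ∀ s, q (S s) + 1 = r
  eq : ∀ s X, ¬ X ⊆ S s → q (X ∪ S s) = r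
  inj : Function.Injective S

/-- The fibres of `D` are spanning circuits of the matroid `N`, of rank `k`. -/
structure IsCircuitPartition [Finite κ] (N : Matroid κ) (k : ℕ) (D : κ → σ) : Prop where
  rk_univ : N.rk univ = k
  rk_fibre : ∀ s, N.rk (D ⁻¹' {s}) = k
  ncard_fibre : ∀ s, (D ⁻¹' {s}).ncard = k + 1
  rk_ssubset : ∀ s, ∀ P ⊂ D ⁻¹' {s}, N.rk P = P.ncard

lemma IsHyperplaneFamily.union_eq {q : Set α → ℕ} {r : ℕ} {S : σ → Set α}
    (h : IsHyperplaneFamily q r S) {s s' : σ} (hs : s ≠ s') :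
    q (S s ∪ S s') = r := by
  by_cases hss : S s ⊆ S s'
  · have h1 : ¬ S s' ⊆ S s := fun h' ↦ hs (h.inj (hss.antisymm h'))
    rw [union_comm]
    exact h.eq _ _ h1
  · exact h.eq _ _ hss

variable {q q' : Set α → ℕ} {r : ℕ} {z : ι → α} {X : Set α} {I : Set (Option ι)} {B : Set ι}

lemma IsExtPair.le_rank (h : IsExtPair q q' r) (X : Set α) : q X ≤ r :=
  h.rank_eq ▸ h.mono (subset_univ X)

lemma IsExtPair.le_rank' (h : IsExtPair q q' r) (X : Set α) : q' X ≤ r :=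
  h.rank_eq' ▸ h.mono' (subset_univ X)

lemma frameRk_le [Finite ι] : frameRk q z X I B ≤ Nat.card (Option ι) + q (X ∪ z '' B) := by
  have h1 : frameRk q z X I B ≤ _ := minOver_le (Subset.rfl (s := B))
  have h2 := ncard_le_card (I ∪ some '' B)
  rw [sdiff_self, ncard_empty] at h1
  omega

lemma frameRk_empty [Finite ι] (h : IsExtPair q q' r) : frameRk q z ∅ ∅ B = B.ncard := by
  refine (eq_minOver (fun P hP ↦ ?_) ⟨∅, empty_subset _, by simp [h.empty]⟩).symm
  have h1 := ncard_sdiff_add_ncard_of_subset hP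
  rw [empty_union, empty_union, ncard_image_of_injective _ (Option.some_injective _)]
  omega

lemma frameRk_univ [Finite ι] (h : IsExtPair q q' r) (hB : z '' B ⊆ X) :
    frameRk q z X univ B = Nat.card (Option ι) + q X := by
  refine le_antisymm ?_ (le_minOver fun P hP ↦ ?_)
  · have := frameRk_le (q := q) (z := z) (X := X) (I := univ) (B := B)
    rwa [union_eq_self_of_subset_right hB] at this
  · rw [univ_union, ncard_univ]
    have := h.mono (subset_union_left (s := X) (t := z '' P))
    omega

variable {k : ℕ} {S : σ → Set α} {D : κ → σ} {π : ι → σ}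
  {Q : Set κ}

lemma biUnion_fibre {P : Set κ} (hP : P.Nonempty) {s : σ} (h : P ⊆ D ⁻¹' {s}) :
    ⋃ y ∈ P, π ⁻¹' {D y} = π ⁻¹' {s} := by
  obtain ⟨y, hy⟩ := hP
  refine (iUnion₂_subset fun y hy ↦ ?_).antisymm ?_
  · rw [show D y = s from h hy]
  · rw [← show D y = s from h hy]
    exact subset_biUnion_of_mem (u := fun y ↦ π ⁻¹' {D y}) hy

lemma subset_fibre_or (P : Set κ) (hP : P.Nonempty) :
    (∃ s, P ⊆ D ⁻¹' {s}) ∨ ∃ y ∈ P, ∃ y' ∈ P, D y ≠ D y' := by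
  by_contra! h
  obtain ⟨y, hy⟩ := hP
  exact h.1 (D y) fun y' hy' ↦ (h.2 y hy y' hy').symm

lemma gadgetRk_empty_right (b : κ → Set ι) {t : Set κ → ℕ} (ht : t ∅ = 0) :
    gadgetRk q q' z b t X I B ∅ = frameRk q z X I B := by
  refine (eq_minOver (fun P hP ↦ ?_) ⟨∅, by simp [ht]⟩).symm
  obtain rfl := subset_empty_iff.1 hP
  simp [ht]

variable [Finite κ] [Finite ι] {N : Matroid κ}

lemma gadgetRk_le (b : κ → Set ι) (h : IsExtPair q q' r) :
    gadgetRk q q' z b N.rk X I B Q ≤ Nat.card (Option ι) + r + N.rk univ := by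
  refine (minOver_le (Subset.rfl (s := Q))).trans ?_
  have h2 := frameRk_le (q := q) (z := z) (X := X) (I := I) (B := B)
  have h3 := h.le_rank (X ∪ z '' B)
  have h4 := h.le_rank' (X ∪ z '' (B ∪ ⋃ y ∈ Q, b y))
  have h5 : N.rk Q ≤ N.rk univ := rk_mono (subset_univ _)
  rw [sdiff_self, ncard_empty]
  split_ifs <;> omega

/-- The extension enters a term of the minimum only through its value at `W`. If `P` meets two
circuits, `W` contains two hyperplanes and has full rank. If `P` is a proper part of one circuit,
the term is no better than that of `∅`. There remains the case that `P` is a whole circuit and `W`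
is its hyperplane. -/
lemma gadgetRk_le_of_agree {q₁ q₂ : Set α → ℕ} (h₁ : IsExtPair q q₁ r) (h₂ : IsExtPair q q₂ r)
    (hS : IsHyperplaneFamily q r S) (hN : IsCircuitPartition N k D)
    (hz : ∀ s, z '' (π ⁻¹' {s}) = S s)
    (hQ : ∀ s, D ⁻¹' {s} ⊆ Q → q₁ (S s) = q₂ (S s) ∨ k + 2 ≤ Q.ncard) :
    gadgetRk q q₂ z (fun y ↦ π ⁻¹' {D y}) N.rk X I B Q ≤
      gadgetRk q q₁ z (fun y ↦ π ⁻¹' {D y}) N.rk X I B Q := by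
  refine le_minOver fun P hP ↦ ?_
  have hle : gadgetRk q q₂ z (fun y ↦ π ⁻¹' {D y}) N.rk X I B Q ≤ _ := minOver_le hP
  by_cases hPe : P = ∅
  · rw [if_pos hPe] at hle ⊢
    exact hle
  rw [if_neg hPe] at hle ⊢
  have hne := nonempty_iff_ne_empty.2 hPe
  set W := X ∪ z '' (B ∪ ⋃ y ∈ P, π ⁻¹' {D y}) with hW
  rcases min_choice (frameRk q z X I (B ∪ ⋃ y ∈ P, π ⁻¹' {D y}) + 1)
    (Nat.card (Option ι) + q₁ W) with h | h
  · rw [h]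
    refine hle.trans ?_
    gcongr
    exact min_le_left _ _
  rw [h]
  have hWr : q W = r → gadgetRk q q₂ z (fun y ↦ π ⁻¹' {D y}) N.rk X I B Q ≤
      Nat.card (Option ι) + q₁ W + N.rk P + (Q \ P).ncard := fun hWr ↦ by
    refine hle.trans ?_
    gcongr
    refine (min_le_right _ _).trans ?_
    have := h₂.le_rank' W
    have := h₁.le' W
    omega
  have hWe : q₁ W = q₂ W → gadgetRk q q₂ z (fun y ↦ π ⁻¹' {D y}) N.rk X I B Q ≤
      Nat.card (Option ι) + q₁ W + N.rk P + (Q \ P).ncard := fun hWe ↦ by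
    rw [hWe]
    refine hle.trans ?_
    gcongr
    exact min_le_right _ _
  rcases subset_fibre_or (D := D) P hne with ⟨s, hs⟩ | ⟨y, hy, y', hy', hyy⟩
  · have hWs : W = (X ∪ z '' B) ∪ S s := by
      rw [hW, biUnion_fibre hne hs, image_union, hz, union_assoc]
    by_cases hss : P = D ⁻¹' {s}
    · by_cases hX : X ∪ z '' B ⊆ S s
      · rw [union_eq_self_of_subset_left hX] at hWs
        rcases hQ s (hss ▸ hP) with h4 | h4
        · exact hWe (hWs ▸ h4)
        · have h5 := gadgetRk_le (N := N) (X := X) (I := I) (B := B) (Q := Q) (z := z)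
            (fun y ↦ π ⁻¹' {D y}) h₂
          have h6 := h₁.le' W
          have h7 := hS.succ s
          have h8 := ncard_sdiff_add_ncard_of_subset hP
          rw [hss, hN.rk_fibre, ← hss]
          have h9 := hN.ncard_fibre s
          rw [← hss] at h9
          rw [hN.rk_univ] at h5
          rw [hWs] at h6 ⊢
          omega
      · exact hWr (hWs ▸ hS.eq s _ hX)
    · have h4 := hN.rk_ssubset s P (hs.ssubset_of_ne hss)
      have h5 := ncard_sdiff_add_ncard_of_subset hP
      have h6 : gadgetRk q q₂ z (fun y ↦ π ⁻¹' {D y}) N.rk X I B Q ≤ _ :=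
        minOver_le (empty_subset Q)
      rw [if_pos rfl, rk_empty, sdiff_empty] at h6
      have h7 := frameRk_le (q := q) (z := z) (X := X) (I := I) (B := B)
      have h8 := h₁.le' W
      have h9 : q (X ∪ z '' B) ≤ q W := h₁.mono (hWs ▸ subset_union_left)
      omega
  · refine hWr (le_antisymm (h₁.le_rank W) ?_)
    rw [← hS.union_eq hyy]
    refine h₁.mono (union_subset ?_ ?_)
    · rw [← hz]
      refine subset_union_of_subset_right (image_mono (subset_union_of_subset_right ?_ _)) _
      exact subset_biUnion_of_mem (u := fun y ↦ π ⁻¹' {D y}) hy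
    · rw [← hz]
      refine subset_union_of_subset_right (image_mono (subset_union_of_subset_right ?_ _)) _
      exact subset_biUnion_of_mem (u := fun y ↦ π ⁻¹' {D y}) hy'

lemma gadgetRk_eq_of_agree {q₁ q₂ : Set α → ℕ} (h₁ : IsExtPair q q₁ r) (h₂ : IsExtPair q q₂ r)
    (hS : IsHyperplaneFamily q r S) (hN : IsCircuitPartition N k D)
    (hz : ∀ s, z '' (π ⁻¹' {s}) = S s)
    (hQ : ∀ s, D ⁻¹' {s} ⊆ Q → q₁ (S s) = q₂ (S s) ∨ k + 2 ≤ Q.ncard) :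
    gadgetRk q q₁ z (fun y ↦ π ⁻¹' {D y}) N.rk X I B Q =
      gadgetRk q q₂ z (fun y ↦ π ⁻¹' {D y}) N.rk X I B Q :=
  le_antisymm (gadgetRk_le_of_agree h₂ h₁ hS hN hz fun s hs ↦ (hQ s hs).imp_left Eq.symm)
    (gadgetRk_le_of_agree h₁ h₂ hS hN hz hQ)

lemma gadgetRk_univ_left (b : κ → Set ι) (h : IsExtPair q q' r) :
    gadgetRk q q' z b N.rk univ univ univ Q = Nat.card (Option ι) + r + N.rk Q := by
  have h1 : frameRk q z univ univ univ = Nat.card (Option ι) + q univ :=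
    frameRk_univ h (subset_univ _)
  rw [h.rank_eq] at h1
  refine (eq_minOver (fun P hP ↦ ?_) ⟨Q, Subset.rfl, ?_⟩).symm
  · have h2 := N.rk_union_le_ncard P (Q \ P)
    rw [union_sdiff_cancel hP] at h2
    rw [univ_union, univ_union, h1, h.rank_eq']
    split_ifs <;> omega
  · rw [univ_union, univ_union, h1, h.rank_eq', sdiff_self, ncard_empty]
    split_ifs <;> omega

/-- The summand `1 + k` is the joint rank of `p` and `N`, whichever circuits are taken. This is what
forces the spans of different circuits to share a subspace of dimension `k + 1` in a representation.
-/
lemma gadgetRk_fibres (h : IsExtPair q q' r) (hN : IsCircuitPartition N k D) {J J' : Set σ}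
    (hJ' : J'.Nonempty) (hJ : J' ⊆ J) :
    gadgetRk q q' z (fun y ↦ π ⁻¹' {D y}) N.rk ∅ ∅ (π ⁻¹' J) (D ⁻¹' J') =
      (π ⁻¹' J).ncard + 1 + k := by
  obtain ⟨s, hs⟩ := hJ'
  have hsub : D ⁻¹' {s} ⊆ D ⁻¹' J' := preimage_mono (singleton_subset_iff.2 hs)
  have hU : ∀ P ⊆ D ⁻¹' J', π ⁻¹' J ∪ ⋃ y ∈ P, π ⁻¹' {D y} = π ⁻¹' J := fun P hP ↦
    union_eq_self_of_subset_right <| iUnion₂_subset fun y hy ↦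
      preimage_mono (singleton_subset_iff.2 (hJ (hP hy)))
  have hrk : N.rk (D ⁻¹' J') = k := le_antisymm (hN.rk_univ ▸ rk_mono (subset_univ _))
    (hN.rk_fibre s ▸ rk_mono hsub)
  -- The spare coloop `none` keeps `p` independent of all elements indexed by `ι`.
  have hcard : (π ⁻¹' J).ncard + 1 ≤ Nat.card (Option ι) := by
    rw [Finite.card_option]
    exact Nat.add_le_add_right (ncard_le_card _) 1
  have hf : frameRk q z ∅ ∅ (π ⁻¹' J) = (π ⁻¹' J).ncard := frameRk_empty h
  refine (eq_minOver (fun P hP ↦ ?_) ⟨_, Subset.rfl, ?_⟩).symm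
  · rw [hU P hP, hf]
    have h1 := N.rk_union_le_ncard P (D ⁻¹' J' \ P)
    rw [union_sdiff_cancel hP, hrk] at h1
    split_ifs with hPe
    · have h2 := ncard_le_ncard hsub
      rw [hN.ncard_fibre] at h2
      rw [hPe, sdiff_empty]
      omega
    · omega
  · rw [hU _ Subset.rfl, hf, hrk, sdiff_self, ncard_empty]
    have : (D ⁻¹' J').Nonempty := Nonempty.mono hsub
      ((ncard_pos).1 (by rw [hN.ncard_fibre]; omega))
    rw [if_neg this.ne_empty]
    omega

/-- This rank reveals whether `S s` spans `e`. -/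
lemma gadgetRk_hyperplane (h : IsExtPair q q' r) (hN : IsCircuitPartition N k D)
    (hz : ∀ s, z '' (π ⁻¹' {s}) = S s) (s : σ) :
    gadgetRk q q' z (fun y ↦ π ⁻¹' {D y}) N.rk (S s) univ (π ⁻¹' {s}) (D ⁻¹' {s}) =
      Nat.card (Option ι) + q' (S s) + k := by
  have hU : ∀ P ⊆ D ⁻¹' {s}, π ⁻¹' {s} ∪ ⋃ y ∈ P, π ⁻¹' {D y} = π ⁻¹' {s} := fun P hP ↦
    union_eq_self_of_subset_right <| iUnion₂_subset fun y hy ↦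
      preimage_mono (singleton_subset_iff.2 (hP hy))
  have hf : frameRk q z (S s) univ (π ⁻¹' {s}) = Nat.card (Option ι) + q (S s) :=
    frameRk_univ h (hz s).subset
  have h1 := h.le_succ (S s)
  refine (eq_minOver (fun P hP ↦ ?_) ⟨_, Subset.rfl, ?_⟩).symm
  · rw [hU P hP, hf, hz, union_self]
    have h1 := N.rk_union_le_ncard P (D ⁻¹' {s} \ P)
    rw [union_sdiff_cancel hP, hN.rk_fibre] at h1
    split_ifs with hPe
    · rw [hPe, sdiff_empty, hN.ncard_fibre]
      omega
    · omega
  · rw [hU _ Subset.rfl, hf, hN.rk_fibre, sdiff_self, ncard_empty, hz, union_self]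
    have : (D ⁻¹' {s}).Nonempty := (ncard_pos).1 (by rw [hN.ncard_fibre]; omega)
    rw [if_neg this.ne_empty]
    omega

end GadgetRank
-- Vector matroids and the common point of a family of subspaces
section VectorMatroid

open Submodule Module

variable {γ F V : Type*} [Field F] [AddCommGroup V] [Module F V]

lemma span_image_mono (w : γ → V) {X Y : Set γ} (h : X ⊆ Y) :
    span F (w '' X) ≤ span F (w '' Y) := span_mono (image_mono h)

variable [Finite γ]

lemma linearIndepOn_iff_finrank {w : γ → V} {I : Set γ} :
    LinearIndepOn F w I ↔ finrank F (span F (w '' I)) = I.ncard := by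
  classical
  have := Fintype.ofFinite I
  rw [LinearIndepOn, linearIndependent_iff_card_eq_finrank_span, Set.finrank,
    ← image_eq_range, ← Nat.card_eq_fintype_card, Nat.card_coe_set_eq, eq_comm]

lemma finrank_eq_rk_of_linearIndepOn {M : Matroid γ} {w : γ → V} (hM : M.E = univ)
    (h : ∀ I ⊆ M.E, M.Indep I ↔ LinearIndepOn F w I) (X : Set γ) :
    finrank F (span F (w '' X)) = M.rk X := by
  obtain ⟨I, hIX, hI, hIr⟩ := M.exists_indep_rk X
  have hIl := (h I (by simp [hM])).1 hI
  rw [← hIr, ← linearIndepOn_iff_finrank.1 hIl]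
  have : span F (w '' X) = span F (w '' I) := by
    refine le_antisymm (span_le.2 ?_) (span_image_mono w hIX)
    rintro _ ⟨x, hx, rfl⟩
    refine hIl.mem_span_iff.2 fun hl ↦ ?_
    by_contra hxI
    have h1 := ((h _ (by simp [hM])).2 hl).ncard_le_rk (insert_subset hx hIX)
    rw [ncard_insert_of_notMem hxI] at h1
    omega
  rw [this]

lemma IsRepresentable.exists_finrank {M : Matroid γ} (hM : M.IsRepresentable F)
    (hE : M.E = univ) :
    ∃ (n : ℕ) (w : γ → (Fin n → F)), ∀ X, finrank F (span F (w '' X)) = M.rk X := by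
  obtain ⟨n, w, hw⟩ := hM
  exact ⟨n, w, finrank_eq_rk_of_linearIndepOn hE hw⟩

variable [FiniteDimensional F V]

variable (F) in
lemma exists_vectorMatroid (w : γ → V) : ∃ M : Matroid γ, M.E = univ ∧ M.IsRepresentable F ∧
    ∀ X, M.rk X = finrank F (span F (w '' X)) := by
  let M : Matroid γ := (IndepMatroid.ofFinite (E := univ) (toFinite _) (LinearIndepOn F w)
    (linearIndepOn_empty F w) (fun I J hJ hIJ ↦ hJ.mono hIJ) (by
      intro I J hI hJ hlt
      by_contra! hc
      have hle : span F (w '' J) ≤ span F (w '' I) := by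
        refine span_le.2 ?_
        rintro _ ⟨x, hx, rfl⟩
        exact hI.mem_span_iff.2 fun h ↦ by_contra fun hxI ↦ hc x hx hxI h
      have := Submodule.finrank_mono hle
      rw [linearIndepOn_iff_finrank.1 hI, linearIndepOn_iff_finrank.1 hJ] at this
      omega) (fun _ _ ↦ subset_univ _)).matroid
  have hM : ∀ I ⊆ M.E, M.Indep I ↔ LinearIndepOn F w I := fun I _ ↦ by
    rw [IndepMatroid.matroid_indep_iff]; rfl
  exact ⟨M, rfl, isRepresentable_of_linearIndepOn w hM, fun X ↦
    (finrank_eq_rk_of_linearIndepOn rfl hM X).symm⟩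

lemma finrank_map_mkQ_add (U W : Submodule F V) :
    finrank F (W.map U.mkQ) + finrank F U = finrank F (W ⊔ U : Submodule F V) := by
  have h1 : W.map U.mkQ = (W ⊔ U).map U.mkQ := by
    rw [Submodule.map_sup, LinearMap.le_ker_iff_map.1 (ker_mkQ U).ge, sup_bot_eq]
  have h2 := (U.mkQ.domRestrict (W ⊔ U)).finrank_range_add_finrank_ker
  rw [LinearMap.range_domRestrict, ← h1, LinearMap.ker_domRestrict, ker_mkQ] at h2
  rw [← h2, (comapSubtypeEquivOfLe (le_sup_right : U ≤ W ⊔ U)).finrank_eq]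

/-- The special point at which a family of subspaces `G s`, that pairwise meet in one and the same
subspace, meets the subspace `V₀`. -/
lemma exists_common_point {σ : Type*} {V₀ : Submodule F V} {B G H : σ → Submodule F V}
    {β ε : σ → ℕ} {t ρ : ℕ} {s₁ s₂ : σ} (hs : s₁ ≠ s₂) (hBG : ∀ s, B s ≤ G s)
    (hBH : ∀ s, B s ≤ H s) (hHV : ∀ s, H s ≤ V₀) (hB : ∀ s, finrank F (B s) = β s)
    (hG : ∀ s, finrank F (G s) = β s + t)
    (hGG : ∀ s s', s ≠ s' → finrank F (G s ⊔ G s' : Submodule F V) = β s + β s' + t)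
    (hGB : ∀ s s', s ≠ s' → finrank F (G s ⊔ B s' : Submodule F V) = β s + β s' + t)
    (hGGG : ∀ s s' s'', s ≠ s' → s ≠ s'' → s' ≠ s'' →
      finrank F (G s ⊔ G s' ⊔ G s'' : Submodule F V) = β s + β s' + β s'' + t)
    (hV₀ : finrank F V₀ = ρ) (hH : ∀ s, finrank F (H s) + 1 = ρ)
    (hVG : ∀ s, finrank F (V₀ ⊔ G s : Submodule F V) + 1 = ρ + t)
    (hHG : ∀ s, finrank F (H s ⊔ G s : Submodule F V) + 2 = ρ + t + ε s) :
    ∃ x ∈ V₀, ∀ s, x ∈ H s ↔ ε s = 0 := by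
  have hdim := fun (A B : Submodule F V) ↦ finrank_sup_add_finrank_inf_eq A B
  have hpair : ∀ s s', s ≠ s' → finrank F (G s ⊓ G s' : Submodule F V) = t := fun s s' h ↦ by
    have := hdim (G s) (G s'); have := hGG s s' h; have := hG s; have := hG s'; omega
  -- Both sides lie in `(G s ⊔ G s') ⊓ G s''`, which has the same dimension `t`.
  have hcommon : ∀ s s' s'', s ≠ s' → s ≠ s'' → s' ≠ s'' → G s ⊓ G s'' = G s' ⊓ G s'' := by
    intro s s' s'' h h' h''
    have h0 : finrank F ((G s ⊔ G s') ⊓ G s'' : Submodule F V) = t := by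
      have := hdim (G s ⊔ G s') (G s''); have := hGG s s' h; have := hGGG s s' s'' h h' h''
      have := hG s''; omega
    rw [Submodule.eq_of_le_of_finrank_eq (inf_le_inf_right (G s'') le_sup_left)
        ((hpair s s'' h').trans h0.symm),
      Submodule.eq_of_le_of_finrank_eq (inf_le_inf_right (G s'') le_sup_right)
        ((hpair s' s'' h'').trans h0.symm)]
  set Y := G s₁ ⊓ G s₂ with hY
  have hYt : finrank F Y = t := hpair _ _ hs
  have hYG : ∀ s, Y ≤ G s := fun s ↦ by
    by_cases h1 : s = s₁
    · rw [h1]; exact inf_le_left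
    by_cases h2 : s = s₂
    · rw [h2]; exact inf_le_right
    rw [hY, hcommon s₁ s s₂ (Ne.symm h1) hs h2]
    exact inf_le_left
  have hGinfB : ∀ s s', s ≠ s' → G s ⊓ B s' = ⊥ := fun s s' h ↦ by
    rw [← Submodule.finrank_eq_zero (R := F)]
    have := hdim (G s) (B s'); have := hGB s s' h; have := hB s'; have := hG s
    omega
  have hYB : ∀ s, Y ⊓ B s = ⊥ := fun s ↦ by
    obtain ⟨s', hs'⟩ : ∃ s', s' ≠ s := by
      by_cases h : s = s₁
      · exact ⟨s₂, fun h' ↦ hs (h ▸ h'.symm)⟩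
      · exact ⟨s₁, fun h' ↦ h h'.symm⟩
    exact eq_bot_iff.2 ((inf_le_inf_right _ (hYG s')).trans (hGinfB s' s hs').le)
  have hGsum : ∀ s, B s ⊔ Y = G s := fun s ↦ by
    refine Submodule.eq_of_le_of_finrank_eq (sup_le (hBG s) (hYG s)) ?_
    have := hdim Y (B s)
    rw [hYB, finrank_bot, sup_comm] at this
    have := hB s; have := hG s; omega
  -- The modular law for `G s = B s ⊕ Y`. It turns the given dimensions into those of `V₀ ⊓ Y`,
  -- which is a line, and of `H s ⊓ Y`, which is that line or zero.
  have hinf : ∀ (W : Submodule F V) s, B s ≤ W →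
      finrank F (W ⊓ G s : Submodule F V) = β s + finrank F (W ⊓ Y : Submodule F V) := by
    intro W s hW
    have h1 : W ⊓ G s = B s ⊔ (W ⊓ Y) := by
      rw [← hGsum, inf_comm, inf_comm W, sup_inf_assoc_of_le _ hW]
    have h2 := hdim (B s) (W ⊓ Y)
    have h3 : B s ⊓ (W ⊓ Y) = ⊥ := eq_bot_iff.2
      ((le_inf (inf_le_right.trans inf_le_right) inf_le_left).trans (hYB s).le)
    rw [h3, finrank_bot, ← h1, hB] at h2
    omega
  have hV1 : finrank F (V₀ ⊓ Y : Submodule F V) = 1 := by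
    have := hinf V₀ s₁ ((hBH s₁).trans (hHV s₁))
    have := hdim V₀ (G s₁); have := hVG s₁; have := hG s₁; omega
  have hH1 : ∀ s, finrank F (H s ⊓ Y : Submodule F V) + ε s = 1 := fun s ↦ by
    have := hinf (H s) s (hBH s)
    have := hdim (H s) (G s); have := hHG s; have := hG s; have := hH s; omega
  obtain ⟨x, hx0, hx⟩ := finrank_eq_one_iff'.1 hV1
  refine ⟨x, x.2.1, fun s ↦ ⟨fun hxH ↦ ?_, fun h ↦ ?_⟩⟩
  · have h1 : finrank F (H s ⊓ Y : Submodule F V) ≠ 0 := fun h ↦ by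
      rw [Submodule.finrank_eq_zero] at h
      have : (x : V) ∈ H s ⊓ Y := ⟨hxH, x.2.2⟩
      rw [h, mem_bot] at this
      exact hx0 (Subtype.ext this)
    have := hH1 s
    omega
  · have h1 : H s ⊓ Y = V₀ ⊓ Y := by
      refine Submodule.eq_of_le_of_finrank_eq (inf_le_inf_right _ (hHV s)) ?_
      have := hH1 s
      omega
    exact (h1.ge x.2).1

end VectorMatroid

/-! ### A representation of the gadget yields a representable extension -/

section GadgetRepresentation

open Submodule Module

/-- The subset of the ground set of the gadget with the given four parts. -/
abbrev gadgetSet {α ι κ : Type*} (X : Set α) (I : Set (Option ι)) (B : Set ι) (Q : Set κ) :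
    Set (((α ⊕ Option ι) ⊕ ι) ⊕ κ) := Sum.inl '' (frameSet X I B) ∪ Sum.inr '' Q

lemma gadgetSet_union {α ι κ : Type*} (X X' : Set α) (I I' : Set (Option ι)) (B B' : Set ι)
    (Q Q' : Set κ) : gadgetSet X I B Q ∪ gadgetSet X' I' B' Q' =
      gadgetSet (X ∪ X') (I ∪ I') (B ∪ B') (Q ∪ Q') := by
  ext (((x | x) | x) | x) <;> simp [gadgetSet, frameSet]

lemma gadgetSet_mono {α ι κ : Type*} {X X' : Set α} {I I' : Set (Option ι)} {B B' : Set ι}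
    {Q Q' : Set κ} (hX : X ⊆ X') (hI : I ⊆ I') (hB : B ⊆ B') (hQ : Q ⊆ Q') :
    gadgetSet X I B Q ⊆ gadgetSet X' I' B' Q' :=
  union_subset_union (image_mono (union_subset_union
    (image_mono (union_subset_union (image_mono hX) (image_mono hI))) (image_mono hB)))
    (image_mono hQ)

variable {α ι κ σ F : Type*} [Finite α] [Finite ι] [Finite κ] [Field F]

/-- The ranks of the gadget are the dimensions that `exists_common_point` asks for. The vector `x`
found there replaces the deleted `p`, and its image modulo the span of the coloops replaces `e`. -/
lemma exists_representable_extension {q q' : Set α → ℕ} {r k : ℕ} {S : σ → Set α} {N : Matroid κ}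
    {D : κ → σ} {π : ι → σ} {z : ι → α} (h : IsExtPair q q' r) (hS : IsHyperplaneFamily q r S)
    (hN : IsCircuitPartition N k D) (hz : ∀ s, z '' (π ⁻¹' {s}) = S s) {s₁ s₂ : σ}
    (hs : s₁ ≠ s₂) {M : Matroid (((α ⊕ Option ι) ⊕ ι) ⊕ κ)} (hE : M.E = univ)
    (hM : M.IsRepresentable F) (hr : ∀ X I B Q, M.rk (gadgetSet X I B Q) =
      gadgetRk q q' z (fun y ↦ π ⁻¹' {D y}) N.rk X I B Q) :
    ∃ K : Matroid (α ⊕ Unit), K.E = univ ∧ K.IsRepresentable F ∧ (∀ X, baseRk K X = q X) ∧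
      extRk K univ = r ∧ ∀ s, extRk K (S s) = q' (S s) := by
  obtain ⟨n, w, hw⟩ := hM.exists_finrank hE
  have hwr : ∀ X I B Q, finrank F (span F (w '' gadgetSet X I B Q)) =
      gadgetRk q q' z (fun y ↦ π ⁻¹' {D y}) N.rk X I B Q := fun X I B Q ↦ by rw [hw, hr]
  have hsup : ∀ A A' : Set (((α ⊕ Option ι) ⊕ ι) ⊕ κ),
      span F (w '' A) ⊔ span F (w '' A') = span F (w '' (A ∪ A')) := fun A A' ↦ by
    rw [image_union, span_union]
  have hdisj : ∀ s s', s ≠ s' → Disjoint (π ⁻¹' {s}) (π ⁻¹' {s'}) := fun s s' hss ↦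
    Disjoint.preimage _ (by simpa using hss)
  have hcard2 : ∀ s s', s ≠ s' →
      (π ⁻¹' {s, s'}).ncard = (π ⁻¹' {s}).ncard + (π ⁻¹' {s'}).ncard := fun s s' hss ↦ by
    rw [← ncard_union_eq (hdisj s s' hss), ← preimage_union]; rfl
  have hcard3 : ∀ s s' s'', s ≠ s' → s ≠ s'' → s' ≠ s'' → (π ⁻¹' {s, s', s''}).ncard =
      (π ⁻¹' {s}).ncard + (π ⁻¹' {s'}).ncard + (π ⁻¹' {s''}).ncard := fun s s' s'' h h' h'' ↦ by
    rw [add_assoc, ← hcard2 s' s'' h'', ← ncard_union_eq, ← preimage_union]; · rfl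
    exact Disjoint.preimage _ (by simp [h, h'])
  have hframe : ∀ X B, z '' B ⊆ X → gadgetRk q q' z (fun y ↦ π ⁻¹' {D y}) N.rk X univ B ∅ =
      Nat.card (Option ι) + q X := fun X B hB ↦ by
    rw [gadgetRk_empty_right _ N.rk_empty, frameRk_univ h hB]
  obtain ⟨x, hxV, hx⟩ := exists_common_point (F := F) (σ := σ)
    (V₀ := span F (w '' gadgetSet univ univ univ ∅))
    (B := fun s ↦ span F (w '' gadgetSet ∅ ∅ (π ⁻¹' {s}) ∅))
    (G := fun s ↦ span F (w '' gadgetSet ∅ ∅ (π ⁻¹' {s}) (D ⁻¹' {s})))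
    (H := fun s ↦ span F (w '' gadgetSet (S s) univ (π ⁻¹' {s}) ∅))
    -- The natural subtraction is exact, as `q ≤ q' ≤ q + 1`; so `ε s` is `0` if `S s` spans `e` and
    -- `1` if not.
    (β := fun s ↦ (π ⁻¹' {s}).ncard) (ε := fun s ↦ q' (S s) - q (S s)) (t := k + 1)
    (ρ := Nat.card (Option ι) + r) hs
    (fun s ↦ span_image_mono _ (gadgetSet_mono Subset.rfl Subset.rfl Subset.rfl (empty_subset _)))
    (fun s ↦ span_image_mono _
      (gadgetSet_mono (empty_subset _) (empty_subset _) Subset.rfl Subset.rfl))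
    (fun s ↦ span_image_mono _
      (gadgetSet_mono (subset_univ _) Subset.rfl (subset_univ _) Subset.rfl))
    (fun s ↦ by rw [hwr, gadgetRk_empty_right _ N.rk_empty, frameRk_empty h])
    (fun s ↦ by rw [hwr, gadgetRk_fibres h hN (singleton_nonempty s) Subset.rfl]; omega)
    (fun s s' hss ↦ by
      rw [hsup, gadgetSet_union, ← preimage_union, ← preimage_union, union_self, union_self, hwr,
        gadgetRk_fibres h hN (singleton_nonempty s).inl Subset.rfl, singleton_union, hcard2 s s' hss]
      omega)
    (fun s s' hss ↦ by
      rw [hsup, gadgetSet_union, ← preimage_union, union_self, union_self, union_empty, hwr,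
        gadgetRk_fibres h hN (singleton_nonempty s) subset_union_left, singleton_union,
        hcard2 s s' hss]
      omega)
    (fun s s' s'' h1 h2 h3 ↦ by
      rw [hsup, gadgetSet_union, hsup, gadgetSet_union, ← preimage_union, ← preimage_union,
        ← preimage_union, ← preimage_union, union_self, union_self, union_self, union_self, hwr,
        gadgetRk_fibres h hN (singleton_nonempty s).inl.inl Subset.rfl, singleton_union,
        insert_union, singleton_union, hcard3 s s' s'' h1 h2 h3]
      omega)
    (by rw [hwr, hframe _ _ (subset_univ _), h.rank_eq])
    (fun s ↦ by rw [hwr, hframe _ _ (hz s).subset, add_assoc, hS.succ])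
    (fun s ↦ by
      rw [hsup, gadgetSet_union, univ_union, univ_union, univ_union, empty_union, hwr,
        gadgetRk_univ_left _ h, hN.rk_fibre]
      omega)
    (fun s ↦ by
      rw [hsup, gadgetSet_union, union_empty, union_empty, union_self, empty_union, hwr,
        gadgetRk_hyperplane h hN hz]
      have := h.le' (S s)
      have := hS.succ s
      omega)
  set U := span F (w '' gadgetSet ∅ univ ∅ ∅) with hU
  let c : α → (((α ⊕ Option ι) ⊕ ι) ⊕ κ) := fun a ↦ Sum.inl (Sum.inl (Sum.inl a))
  let v : α ⊕ Unit → (Fin n → F) ⧸ U := Sum.elim (fun a ↦ U.mkQ (w (c a))) fun _ ↦ U.mkQ x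
  obtain ⟨K, hKE, hKF, hKr⟩ := exists_vectorMatroid F v
  have hUr : finrank F U = Nat.card (Option ι) := by
    rw [hU, hwr, hframe _ _ (by simp), h.empty, add_zero]
  have hspan : ∀ X : Set α, span F (w '' (c '' X)) ⊔ U = span F (w '' gadgetSet X univ ∅ ∅) := by
    intro X
    have : c '' X = gadgetSet X ∅ ∅ ∅ := by
      simp [gadgetSet, frameSet, image_image, c]
    rw [this, hU, hsup, gadgetSet_union]
    simp only [union_empty, empty_union]
  have hbase : ∀ X, baseRk K X = q X := fun X ↦ by
    have h1 : v '' (Sum.inl '' X) =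
        U.mkQ '' (w '' (c '' X)) := by simp only [image_image, v, Sum.elim_inl]
    have h2 := finrank_map_mkQ_add U (span F (w '' (c '' X)))
    rw [hspan, hUr, hwr, hframe _ _ (by simp), map_span, ← h1] at h2
    rw [baseRk, hKr]
    omega
  have hext : ∀ X, extRk K X + Nat.card (Option ι) =
      finrank F (span F {x} ⊔ span F (w '' gadgetSet X univ ∅ ∅) : Submodule F _) := fun X ↦ by
    have h1 : v ''
        (insert (Sum.inr ()) (Sum.inl '' X)) = U.mkQ '' (insert x (w '' (c '' X))) := by
      simp only [image_image, v, Sum.elim_inl, image_insert_eq, Sum.elim_inr]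
    rw [← hspan, ← sup_assoc, ← span_insert, ← finrank_map_mkQ_add, hUr, map_span, ← h1, extRk, hKr]
  have hin : ∀ X, x ∈ span F (w '' gadgetSet X univ ∅ ∅) → extRk K X = q X := fun X hX ↦ by
    have := hext X
    rw [sup_eq_right.2 ((span_singleton_le_iff_mem _ _).2 hX), hwr, hframe _ _ (by simp)] at this
    omega
  -- The element indexed by `i` lies in the span of `z i` and the coloops, so `B` adds nothing.
  have hB : ∀ X B, z '' B ⊆ X → span F (w '' gadgetSet X univ B ∅) =
      span F (w '' gadgetSet X univ (∅ : Set ι) (∅ : Set κ)) := fun X B hB ↦ by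
    refine (Submodule.eq_of_le_of_finrank_eq (span_image_mono _
      (gadgetSet_mono Subset.rfl Subset.rfl (empty_subset _) Subset.rfl)) ?_).symm
    rw [hwr, hwr, hframe _ _ hB, hframe _ _ (by simp)]
  refine ⟨K, hKE, hKF, hbase, ?_, fun s ↦ ?_⟩
  · rw [← h.rank_eq]
    exact hin univ (hB univ univ (subset_univ _) ▸ hxV)
  · have hxs := hx s
    rw [hB _ _ (hz s).subset] at hxs
    have h1 := h.le' (S s)
    have h2 := h.le_succ (S s)
    by_cases hxS : x ∈ span F (w '' gadgetSet (S s) univ (∅ : Set ι) (∅ : Set κ))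
    · rw [hin _ hxS]
      have := hxs.1 hxS
      omega
    · have h3 := hext (S s)
      have h4 := finrank_sup_add_finrank_inf_eq (span F {x})
        (span F (w '' gadgetSet (S s) univ (∅ : Set ι) (∅ : Set κ)))
      have hx0 : x ≠ 0 := fun h0 ↦ hxS (h0 ▸ zero_mem _)
      rw [((disjoint_span_singleton' hx0).2 hxS).symm.eq_bot, finrank_bot, ← h3,
        finrank_span_singleton hx0, hwr, hframe _ _ (by simp)] at h4
      have h5 : ¬ (q' (S s) - q (S s) = 0) := fun h ↦ hxS (hxs.2 h)
      omega

end GadgetRepresentation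

/-! ### Spanning circuits from bases -/

section CircuitSum

open Submodule Module

variable {τ F V : Type*} [Field F] [AddCommGroup V] [Module F V] [Fintype τ]

/-- A linearly independent family, extended by the sum of its members. -/
def optionSum (b : τ → V) : Option τ → V := fun o ↦ o.elim (∑ t, b t) b

/-- The sum has a nonzero coefficient at every `b t`, so it can replace any one of them. -/
lemma linearIndepOn_optionSum {b : τ → V} (hb : LinearIndependent F b) {P : Set (Option τ)}
    (hP : P ≠ univ) : LinearIndepOn F (optionSum b) P := by
  classical
  have hsome : ∀ T : Set τ, LinearIndepOn F (optionSum b) (some '' T) := fun T ↦ by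
    rw [linearIndepOn_image (Option.some_injective _).injOn]
    exact hb.linearIndepOn T
  by_cases hn : none ∈ P
  · obtain ⟨T, hT⟩ : ∃ T : Set τ, P = insert none (some '' T) := by
      refine ⟨some ⁻¹' P, ?_⟩
      ext (_ | x) <;> simp [hn]
    obtain ⟨t, ht⟩ : ∃ t, t ∉ T := by
      by_contra! h
      refine hP (hT.trans ?_)
      ext (_ | x) <;> simp [h]
    rw [hT]
    refine (hsome T).insert fun hmem ↦ ?_
    rw [← image_comp] at hmem
    have h1 : b t ∈ span F (b '' {t}ᶜ) := by
      have h2 : b t = optionSum b none - ∑ s ∈ Finset.univ.erase t, b s := by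
        rw [eq_sub_iff_add_eq, Finset.add_sum_erase _ _ (Finset.mem_univ t)]; rfl
      rw [h2]
      refine sub_mem (span_mono (image_mono ?_) hmem) (sum_mem fun s hs ↦ subset_span ⟨s, ?_, rfl⟩)
      · rintro s hs rfl
        exact ht hs
      · exact Finset.ne_of_mem_erase hs
    exact hb.notMem_span_image (by simp) h1
  · have : P = some '' (some ⁻¹' P) := by
      ext (_ | x) <;> simp [hn]
    rw [this]
    exact hsome _

lemma finrank_span_optionSum {b : τ → V} (hb : LinearIndependent F b) :
    finrank F (span F (optionSum b '' univ)) = Fintype.card τ := by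
  rw [← finrank_span_eq_card hb]
  have : span F (optionSum b '' univ) = span F (range b) := by
    refine le_antisymm (span_le.2 ?_) (span_mono ?_)
    · rintro _ ⟨_ | t, -, rfl⟩
      · exact sum_mem fun s _ ↦ subset_span ⟨s, rfl⟩
      · exact subset_span ⟨t, rfl⟩
    · rintro _ ⟨t, rfl⟩
      exact ⟨some t, mem_univ _, rfl⟩
  rw [this]

end CircuitSum

/-! ### A matroid of circuits hiding many copies of a given matroid -/

section BlockMatroid

open Submodule Module

variable {F m : Type*} [Field F] {n k : ℕ}

/-- The index set of the coordinates: `k` blocks, each with a coordinate for each of `n` and a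
coordinate for each element of `m`. -/
abbrev BlockIndex (m : Type*) (n k : ℕ) : Type _ := Fin k × (Fin n ⊕ m)

/-- The inclusion of `F ^ n` as the first part of the block with number `i`. -/
def blockIncl (F m : Type*) [Field F] {n k : ℕ} (i : Fin k) :
    (Fin n → F) →ₗ[F] (BlockIndex m n k → F) where
  toFun x := fun t ↦ t.2.elim (fun c ↦ if t.1 = i then x c else 0) fun _ ↦ 0
  map_add' x y := by
    ext ⟨a, c | j⟩
    · by_cases h : a = i <;> simp [h]
    · simp
  map_smul' r x := by
    ext ⟨a, c | j⟩
    · by_cases h : a = i <;> simp [h]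
    · simp

@[simp] lemma blockIncl_inl (i a : Fin k) (x : Fin n → F) (c : Fin n) :
    blockIncl F m i x (a, Sum.inl c) = if a = i then x c else 0 := rfl

@[simp] lemma blockIncl_inr (i a : Fin k) (x : Fin n → F) (j : m) :
    blockIncl F m i x (a, Sum.inr j) = 0 := rfl

/-- The basis obtained from the standard basis by adding, in each block, the vector `w j` to the
standard basis vector indexed by `j`. -/
noncomputable def shearedBasis [DecidableEq m] (w : m → Fin n → F) (t : BlockIndex m n k) :
    BlockIndex m n k → F :=
  Pi.single t 1 + t.2.elim (fun _ ↦ 0) fun j ↦ blockIncl F m t.1 (w j)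

variable [Fintype m]

lemma linearIndependent_shearedBasis [DecidableEq m] (w : m → Fin n → F) :
    LinearIndependent F (shearedBasis (k := k) w) := by
  rw [Fintype.linearIndependent_iff]
  intro g hg
  have h1 : ∀ i j, g (i, Sum.inr j) = 0 := fun i j ↦ by
    have := congrFun hg (i, Sum.inr j)
    rw [Finset.sum_apply, Finset.sum_eq_single (i, Sum.inr j)] at this
    · simpa [shearedBasis] using this
    · rintro ⟨a, c | l⟩ - hne
      · simp [shearedBasis]
      · simp [shearedBasis, hne.symm]
    · simp
  rintro ⟨i, c | j⟩
  · have := congrFun hg (i, Sum.inl c)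
    rw [Finset.sum_apply, Finset.sum_eq_single (i, Sum.inl c)] at this
    · simpa [shearedBasis] using this
    · rintro ⟨a, c | l⟩ - hne
      · simp [shearedBasis, hne.symm]
      · simp [h1]
    · simp
  · exact h1 i j

variable {σ : Type*}

/-- The elements of the blocks with number less than `i`. -/
def blocksBelow (σ m : Type*) (n k i : ℕ) : Set (σ × Option (BlockIndex m n k)) :=
  {y | ∃ t ∈ y.2, (t.1 : ℕ) < i}

/-- The elements of the circuit `s` and the block `i` that correspond to elements of `T ⊆ m`. -/
def blockPart (s : σ) {m : Type*} (n : ℕ) {k : ℕ} (i : Fin k) (T : Set m) :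
    Set (σ × Option (BlockIndex m n k)) :=
  (fun j ↦ (s, some (i, Sum.inr j))) '' T

/-- The number of coordinates in the blocks with number less than `i`. -/
lemma ncard_blocks_lt {i : ℕ} (hi : i ≤ k) :
    {t : BlockIndex m n k | (t.1 : ℕ) < i}.ncard = i * (n + Fintype.card m) := by
  have h1 : {t : BlockIndex m n k | (t.1 : ℕ) < i} = {a : Fin k | (a : ℕ) < i} ×ˢ univ := by
    ext t; simp
  have h2 : {a : Fin k | (a : ℕ) < i}.ncard = i := by
    have : {a : Fin k | (a : ℕ) < i} = range (Fin.castLE hi) := by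
      ext a
      exact ⟨fun h ↦ ⟨⟨a, h⟩, rfl⟩, by rintro ⟨b, rfl⟩; exact b.2⟩
    rw [this, ← image_univ, ncard_image_of_injective _ (Fin.castLE_injective hi), ncard_univ,
      Nat.card_eq_fintype_card, Fintype.card_fin]
  rw [h1, ncard_prod, h2, ncard_univ, Nat.card_eq_fintype_card, Fintype.card_sum, Fintype.card_fin]

/-- The circuit of `s₂` comes from the sheared basis, every other one from the standard basis. The
circuit of `s₁` supplies the standard vectors of block `i` indexed by `m`; modulo these and the
earlier blocks, the sheared vector of `j` becomes `w j` in a copy of `F ^ n`. So each block hides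
the vector matroid of `w`. -/
lemma exists_blockMatroid [Finite σ] {s₁ s₂ : σ} (hs : s₁ ≠ s₂) (w : m → Fin n → F) (k : ℕ) :
    ∃ N : Matroid (σ × Option (BlockIndex m n k)), N.E = univ ∧ N.IsRepresentable F ∧
      IsCircuitPartition N (k * (n + Fintype.card m)) Prod.fst ∧
      (∀ i ≤ k, N.rk (blocksBelow σ m n k i) = i * (n + Fintype.card m)) ∧
      ∀ (i : Fin k) (T : Set m),
        N.rk (blocksBelow σ m n k i ∪ blockPart s₁ n i univ ∪ blockPart s₂ n i T) =
          i * (n + Fintype.card m) + Fintype.card m + finrank F (span F (w '' T)) := by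
  classical
  let V := BlockIndex m n k → F
  let b : σ → BlockIndex m n k → V := fun s ↦
    if s = s₂ then shearedBasis w else fun t ↦ Pi.single t 1
  have hb : ∀ s, LinearIndependent F (b s) := fun s ↦ by
    by_cases h : s = s₂
    · simp only [b, if_pos h]; exact linearIndependent_shearedBasis w
    · simp only [b, if_neg h]; exact Pi.linearIndependent_single_one _ F
  let v : σ × Option (BlockIndex m n k) → V := fun y ↦ optionSum (b y.1) y.2
  have hcard : Fintype.card (BlockIndex m n k) = k * (n + Fintype.card m) := by
    simp [BlockIndex]
  have hv1 : ∀ t, v (s₁, some t) = Pi.single t 1 := fun t ↦ by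
    simp [v, optionSum, b, hs]
  have hv2 : ∀ t, v (s₂, some t) = shearedBasis w t := fun t ↦ by
    simp [v, optionSum, b]
  have hspan : ∀ U : Set (BlockIndex m n k), Pi.spanSubset F U =
      span F (v '' ((fun t ↦ (s₁, some t)) '' U)) := fun U ↦ by
    rw [image_image]
    simp only [hv1, Pi.spanSubset, Pi.basisFun_apply]
  obtain ⟨N, hNE, hNF, hNr⟩ := exists_vectorMatroid F v
  -- Shearing stays within a block, and the sums, indexed by `none`, belong to no block.
  have hbelow : ∀ i : ℕ, span F (v '' blocksBelow σ m n k i) =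
      Pi.spanSubset F {t : BlockIndex m n k | (t.1 : ℕ) < i} := fun i ↦ by
    refine le_antisymm (span_le.2 ?_) ?_
    · rintro _ ⟨⟨s, _⟩, ⟨t, rfl, ht⟩, rfl⟩
      rw [SetLike.mem_coe, Pi.mem_spanSubset_iff]
      intro t' ht'
      have hne : t' ≠ t := by rintro rfl; exact ht' ht
      by_cases h : s = s₂
      · rw [h, hv2]
        obtain ⟨a, c | j⟩ := t
        · simp [shearedBasis, hne]
        · obtain ⟨a', c' | j'⟩ := t'
          · have : a' ≠ a := by rintro rfl; exact ht' ht
            simp [shearedBasis, this]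
          · simp [shearedBasis, hne]
      · simp [v, optionSum, b, h, hne]
    · rw [hspan]
      refine span_mono (image_mono ?_)
      rintro _ ⟨t, ht, rfl⟩
      exact ⟨t, rfl, ht⟩
  have hfib : ∀ s, (Prod.fst ⁻¹' {s} : Set (σ × Option (BlockIndex m n k))) =
      Prod.mk s '' univ := fun s ↦ by
    ext ⟨s', o⟩; simp [eq_comm]
  have hvs : ∀ s (P : Set (Option (BlockIndex m n k))),
      v '' (Prod.mk s '' P) = optionSum (b s) '' P := fun s P ↦ by rw [image_image]
  have hrs : ∀ s, N.rk (Prod.fst ⁻¹' {s}) = k * (n + Fintype.card m) := fun s ↦ by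
    rw [hNr, hfib, hvs, finrank_span_optionSum (hb s), hcard]
  refine ⟨N, hNE, hNF, ⟨?_, hrs, fun s ↦ ?_, fun s P hP ↦ ?_⟩, fun i hi ↦ ?_, fun i T ↦ ?_⟩
  · refine le_antisymm ?_ ((hrs s₁).symm.le.trans (rk_mono (subset_univ _)))
    rw [hNr, ← hcard]
    exact (Submodule.finrank_le _).trans (Module.finrank_fintype_fun_eq_card F).le
  · rw [hfib, ncard_image_of_injective _ (Prod.mk_right_injective s), ncard_univ,
      Nat.card_eq_fintype_card, Fintype.card_option, hcard]
  · rw [hfib] at hP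
    obtain ⟨R, -, rfl⟩ := subset_image_iff.1 hP.subset
    rw [hNr, hvs, ncard_image_of_injective _ (Prod.mk_right_injective s)]
    refine linearIndepOn_iff_finrank.1 (linearIndepOn_optionSum (hb s) ?_)
    rintro rfl
    exact hP.ne rfl
  · rw [hNr, hbelow, Pi.dim_spanSubset, ncard_blocks_lt hi]
  · set U : Set (BlockIndex m n k) := {t | (t.1 : ℕ) < i} ∪ (fun j ↦ (i, Sum.inr j)) '' univ with hU
    have hUc : U.ncard = i * (n + Fintype.card m) + Fintype.card m := by
      rw [hU, ncard_union_eq, ncard_blocks_lt i.2.le, ncard_image_of_injective, ncard_univ,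
        Nat.card_eq_fintype_card]
      · intro j j' h; simpa using h
      · rw [disjoint_left]
        rintro _ h ⟨j, -, rfl⟩
        exact lt_irrefl (i : ℕ) h
    have h1 : span F (v '' (blocksBelow σ m n k i ∪ blockPart s₁ n i univ)) =
        Pi.spanSubset F U := by
      rw [image_union, span_union, hbelow, hU, hspan, hspan, image_union, image_union, span_union,
        image_image, image_image, blockPart, image_image, image_image]
    have h2 : span F (v '' (blocksBelow σ m n k i ∪ blockPart s₁ n i univ ∪ blockPart s₂ n i T)) =
        Pi.spanSubset F U ⊔ (span F (w '' T)).map (blockIncl F m i) := by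
      rw [image_union, span_union, h1, map_span]
      have hj : ∀ j, v (s₂, some (i, Sum.inr j)) =
          Pi.single (i, Sum.inr j) 1 + blockIncl F m i (w j) := fun j ↦ hv2 _
      have hmem : ∀ j : m, (Pi.single (i, Sum.inr j) 1 : V) ∈ Pi.spanSubset F U := fun j ↦ by
        rw [hspan, ← hv1]
        exact subset_span ⟨_, ⟨_, Or.inr ⟨j, mem_univ _, rfl⟩, rfl⟩, rfl⟩
      apply le_antisymm
      · refine sup_le le_sup_left (span_le.2 ?_)
        rintro _ ⟨_, ⟨j, hjT, rfl⟩, rfl⟩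
        rw [hj]
        exact add_mem (mem_sup_left (hmem j))
          (mem_sup_right (subset_span ⟨_, ⟨j, hjT, rfl⟩, rfl⟩))
      · refine sup_le le_sup_left (span_le.2 ?_)
        rintro _ ⟨_, ⟨j, hjT, rfl⟩, rfl⟩
        rw [← add_sub_cancel_left (Pi.single (i, Sum.inr j) 1 : V) (blockIncl F m i (w j)), ← hj]
        exact sub_mem (mem_sup_right (subset_span ⟨_, ⟨j, hjT, rfl⟩, rfl⟩))
          (mem_sup_left (hmem j))
    have hinj : Function.Injective (blockIncl F m (n := n) i) := fun x y h ↦ by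
      ext c
      simpa using congrFun h (i, Sum.inl c)
    have hdisj : Pi.spanSubset F U ⊓ (span F (w '' T)).map (blockIncl F m i) = ⊥ := by
      rw [eq_bot_iff]
      rintro _ ⟨hx, x, -, rfl⟩
      rw [SetLike.mem_coe, Pi.mem_spanSubset_iff] at hx
      have : x = 0 := by
        ext c
        simpa using hx (i, Sum.inl c) (by simp [hU])
      rw [this, map_zero]
      exact zero_mem _
    have h3 := finrank_sup_add_finrank_inf_eq (Pi.spanSubset F U)
      ((span F (w '' T)).map (blockIncl F m i))
    rw [hdisj, finrank_bot, add_zero,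
      ← (Submodule.equivMapOfInjective _ hinj (span F (w '' T))).finrank_eq] at h3
    rw [hNr, h2, h3, Pi.dim_spanSubset, hUc]

end BlockMatroid

/-! ### Recovering the hidden matroid -/

section Extraction

open Submodule Module

lemma contract_indep_iff_rk {γ : Type*} [Finite γ] {M : Matroid γ} {C J : Set γ} (hJ : Disjoint C J) :
    (M ／ C).Indep J ↔ M.rk (C ∪ J) = M.rk C + J.ncard := by
  obtain ⟨I, hI⟩ := M.exists_isBasis' C
  have h1 : M.rk I = M.rk C := by
    rw [← M.rk_closure I, ← M.rk_closure C, hI.closure_eq_closure]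
  rw [hI.contract_indep_iff, and_iff_left hJ, union_comm, indep_iff_rk,
    rk_union_eq_of_rk_eq hI.subset h1, ncard_union_eq (hJ.mono_left hI.subset), ← h1,
    indep_iff_rk.1 hI.indep]

variable {F m σ ρ : Type*} [Field F] [Fintype m] [Finite σ] [Finite ρ] {n k c : ℕ}

/-- Contracting the whole left part would give `N`. Contracting only `C` lets the blocks gain more
rank than in `N`, but at most `c` in total; as there are more than `c` blocks, some block gains
nothing, and in it the ranks relative to the earlier blocks are those of `N`. -/
lemma exists_isMinor_of_blocks {s₁ s₂ : σ} (hs : s₁ ≠ s₂) (w : m → Fin n → F)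
    {N : Matroid (σ × Option (BlockIndex m n k))}
    (hN : N.rk univ = k * (n + Fintype.card m))
    (hNb : ∀ i ≤ k, N.rk (blocksBelow σ m n k i) = i * (n + Fintype.card m))
    (hNp : ∀ (i : Fin k) (T : Set m),
      N.rk (blocksBelow σ m n k i ∪ blockPart s₁ n i univ ∪ blockPart s₂ n i T) =
        i * (n + Fintype.card m) + Fintype.card m + finrank F (span F (w '' T)))
    {M : Matroid (ρ ⊕ σ × Option (BlockIndex m n k))} (hE : M.E = univ)
    (hM : ∀ Q, M.rk (range Sum.inl ∪ Sum.inr '' Q) = c + N.rk Q) (hk : c < k)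
    {C D : Set (ρ ⊕ σ × Option (BlockIndex m n k))} (hC : C ⊆ range Sum.inl)
    (hD : D ⊆ range Sum.inl) :
    ∃ N' : Matroid (ρ ⊕ σ × Option (BlockIndex m n k)), N'.IsMinor (M ／ C ＼ D) ∧
      ∃ e : m → ρ ⊕ σ × Option (BlockIndex m n k), Function.Injective e ∧ N'.E = range e ∧
        ∀ T, N'.Indep (e '' T) ↔ LinearIndepOn F w T := by
  set h := n + Fintype.card m with hh
  let f : Set (σ × Option (BlockIndex m n k)) → ℕ := fun Q ↦ M.rk (C ∪ Sum.inr '' Q)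
  have hdisj : Disjoint (range (Sum.inl : ρ → ρ ⊕ σ × Option (BlockIndex m n k)))
    (range Sum.inr) := isCompl_range_inl_range_inr.disjoint
  -- By submodularity, growth over the smaller set `C` is at least growth over the whole left part,
  -- which is growth in `N`.
  have hsub : ∀ Q Q', Q ⊆ Q' → N.rk Q' + f Q ≤ f Q' + N.rk Q := fun Q Q' hQ ↦ by
    have h1 := M.rk_inter_add_rk_union_le (C ∪ Sum.inr '' Q') (range Sum.inl ∪ Sum.inr '' Q)
    have h2 : f Q ≤ M.rk ((C ∪ Sum.inr '' Q') ∩ (range Sum.inl ∪ Sum.inr '' Q)) :=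
      rk_mono (subset_inter (union_subset_union_right _ (image_mono hQ))
        (union_subset_union_left _ hC))
    have h3 : M.rk (range Sum.inl ∪ Sum.inr '' Q') ≤
        M.rk ((C ∪ Sum.inr '' Q') ∪ (range Sum.inl ∪ Sum.inr '' Q)) := rk_mono
      (union_subset (subset_union_left.trans subset_union_right)
        (subset_union_right.trans subset_union_left))
    rw [hM] at h1 h3
    simp only [f]
    simp only [f] at h2
    omega
  have hfuniv : ∀ Q, f Q ≤ c + k * h := fun Q ↦ by
    rw [← hN, ← hM]
    exact rk_mono (union_subset_union hC (image_mono (subset_univ _)))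
  have hmono : Monotone (blocksBelow σ m n k) := fun i j hij y ⟨t, ht, hti⟩ ↦
    ⟨t, ht, hti.trans_le hij⟩
  obtain ⟨i, hi⟩ : ∃ i : Fin k, f (blocksBelow σ m n k (i + 1)) ≤ f (blocksBelow σ m n k i) + h := by
    by_contra! hc
    have : ∀ i ≤ k, i * (h + 1) ≤ f (blocksBelow σ m n k i) := by
      intro i
      induction i with
      | zero => simp
      | succ i ih =>
        intro hik
        have h1 := ih (by omega)
        have h2 : f (blocksBelow σ m n k i) + h < f (blocksBelow σ m n k (i + 1)) :=
          hc ⟨i, by omega⟩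
        rw [add_mul]
        omega
    have h1 := this k le_rfl
    have h2 := hfuniv (blocksBelow σ m n k k)
    rw [mul_add] at h1
    omega
  have hpart : ∀ (s : σ) (T : Set m), blockPart s n i T ⊆ blocksBelow σ m n k (i + 1) := by
    rintro s T _ ⟨j, -, rfl⟩
    exact ⟨_, rfl, Nat.lt_succ_self _⟩
  set Y := blocksBelow σ m n k i ∪ blockPart s₁ n i univ with hY
  -- Block `i` as a whole grows no more than in `N`, so `hsub` below and above the intermediate set
  -- must hold with equality.
  have hval : ∀ T : Set m, f (Y ∪ blockPart s₂ n i T) =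
      f (blocksBelow σ m n k i) + Fintype.card m + finrank F (span F (w '' T)) := fun T ↦ by
    have h1 := hsub (blocksBelow σ m n k i) (Y ∪ blockPart s₂ n i T)
      (subset_union_left.trans subset_union_left)
    have h2 := hsub (Y ∪ blockPart s₂ n i T) (blocksBelow σ m n k (i + 1))
      (union_subset (union_subset (hmono (Nat.le_succ _)) (hpart _ _)) (hpart _ _))
    rw [hNp, hNb _ i.2.le] at h1
    rw [hNp, hNb _ i.2, Nat.succ_mul] at h2
    omega
  let e : m → ρ ⊕ σ × Option (BlockIndex m n k) := fun j ↦ Sum.inr (s₂, some (i, Sum.inr j))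
  have he : Function.Injective e := fun j j' hj ↦ by simpa [e] using hj
  have heT : ∀ T, e '' T = Sum.inr '' (blockPart s₂ n i T) := fun T ↦ by
    rw [blockPart, image_image]
  have heY : ∀ T, Disjoint (C ∪ Sum.inr '' Y) (e '' T) := fun T ↦ by
    rw [heT, disjoint_union_left, disjoint_image_iff Sum.inr_injective]
    refine ⟨hdisj.mono hC (image_subset_range _ _), ?_⟩
    rw [disjoint_left]
    rintro _ (⟨t, ht, hti⟩ | ⟨j', -, hj'⟩) ⟨j, -, rfl⟩
    · rw [Option.mem_some_iff] at ht
      exact lt_irrefl (i : ℕ) (by rwa [← ht] at hti)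
    · exact hs (congrArg Prod.fst hj')
  have heD : Disjoint D (range e) := by
    rw [← image_univ, heT]
    exact hdisj.mono hD (image_subset_range _ _)
  have hYD : Disjoint D (Sum.inr '' Y) := hdisj.mono hD (image_subset_range _ _)
  refine ⟨M ／ (C ∪ Sum.inr '' Y) ＼ (range e)ᶜ, ?_, e, he, ?_, fun T ↦ ?_⟩
  · have h1 : M ／ (C ∪ Sum.inr '' Y) ＼ (range e)ᶜ =
        M ／ C ＼ D ／ (Sum.inr '' Y) ＼ (range e)ᶜ := by
      rw [← contract_delete_comm _ hYD.symm, contract_contract, delete_delete,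
        union_eq_self_of_subset_left (subset_compl_iff_disjoint_right.2 heD)]
    rw [h1]
    exact contract_delete_isMinor _ _ _
  · rw [delete_ground, contract_ground, hE, sdiff_compl,
      inter_eq_self_of_subset_right]
    rw [← compl_eq_univ_sdiff, subset_compl_iff_disjoint_left, ← image_univ]
    exact heY univ
  · rw [delete_indep_iff, contract_indep_iff_rk (heY T), and_iff_left
      (disjoint_compl_right_iff_subset.2 (image_subset_range _ _)),
      ncard_image_of_injective _ he, heT, union_assoc, ← image_union]
    have h1 := hval T
    have h2 := hval ∅
    rw [blockPart, image_empty, union_empty, image_empty, span_empty, finrank_bot] at h2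
    rw [linearIndepOn_iff_finrank]
    simp only [f] at h1 h2
    omega

end Extraction

/-! ### Single-element extensions and hyperplanes -/

section SingleElementExtension

open Submodule Module

lemma IsRepresentable.comap {α β F : Type*} [Field F] {M : Matroid β} (hM : M.IsRepresentable F)
    {f : α → β} (hf : Function.Injective f) : (M.comap f).IsRepresentable F := by
  refine IsRepresentable.of_isIsomorphic ?_ (comap_isIsomorphic_restrict hf).symm
  rw [← delete_compl inter_subset_right]
  exact hM.delete _

lemma isRepresentable_restrict_empty {α F : Type*} [Field F] (M : Matroid α) :
    (M ↾ ∅).IsRepresentable F := by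
  refine ⟨0, 0, fun I hI ↦ ?_⟩
  obtain rfl := subset_empty_iff.1 hI
  simp

/-- A class with a matroid that is not representable has a member which is the extension by a
single element of a representable matroid but is not representable itself. -/
lemma exists_minimal_extension {F : Type v} [Field F] {𝓜 : MatroidClass.{u}}
    (h𝓜 : 𝓜.IsExtensionClosed) {β : Type u} {P : Matroid β} (hP : 𝓜 β P) (hfin : P.Finite)
    (hPF : ¬ P.IsRepresentable F) :
    ∃ (α : Type u) (_ : Finite α) (K : Matroid (α ⊕ Unit)), K.E = univ ∧ 𝓜 _ K ∧
      ¬ K.IsRepresentable F ∧ (K.comap Sum.inl).IsRepresentable F := by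
  have hs : {X | X ⊆ P.E ∧ ¬ (P ↾ X).IsRepresentable F}.Finite :=
    hfin.ground_finite.finite_subsets.subset fun X hX ↦ hX.1
  obtain ⟨X, hX⟩ := hs.exists_minimal ⟨P.E, Subset.rfl, by rwa [restrict_ground_eq_self]⟩
  have hXE : X ⊆ P.E := hX.prop.1
  obtain ⟨e, he⟩ : X.Nonempty := by
    rw [nonempty_iff_ne_empty]
    rintro rfl
    exact hX.prop.2 (isRepresentable_restrict_empty P)
  have hXe : (P ↾ (X \ {e})).IsRepresentable F := by
    by_contra hc
    have := hX.le_of_le ⟨sdiff_subset.trans hXE, hc⟩ sdiff_subset he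
    exact this.2 rfl
  let f : ↥(X \ {e}) ⊕ Unit → β := Sum.elim (↑) fun _ ↦ e
  have hf : Function.Injective f := by
    rintro (x | x) (y | y) hxy
    · exact congrArg _ (Subtype.ext hxy)
    · exact absurd hxy x.2.2
    · exact absurd hxy.symm y.2.2
    · rfl
  have hfr : range f = X := by
    rw [Sum.elim_range, Subtype.range_coe, range_const, sdiff_union_self, union_singleton,
      insert_eq_of_mem he]
  have : Finite ↥(X \ {e}) := ((hfin.ground_finite.subset hXE).subset sdiff_subset).to_subtype
  refine ⟨↥(X \ {e}), this, (P ↾ X).comap f, ?_, ?_, fun hc ↦ ?_, ?_⟩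
  · exact preimage_eq_univ_iff.2 hfr.le
  · exact h𝓜.comap (h𝓜.minor _ _ _ hP ⟨∅, P.E \ X, by
      rw [contract_empty, delete_compl hXE]⟩) hf
  · have h1 := hc.of_isIsomorphic (comap_isIsomorphic_restrict hf)
    rw [hfr, restrict_ground_eq, inter_self, restrict_restrict_eq _ Subset.rfl] at h1
    exact hX.prop.2 h1
  · have h1 : ((P ↾ X).comap f).comap Sum.inl =
        (P ↾ (X \ {e})).comap (Subtype.val : ↥(X \ {e}) → β) := by
      refine ext_indep ?_ fun I _ ↦ ?_
      · ext x
        simp [f, x.2.1, x.2.2]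
      · have h2 : f '' (Sum.inl '' I) = Subtype.val '' I := by rw [image_image]; rfl
        rw [comap_indep_iff, comap_indep_iff, comap_indep_iff, h2, restrict_indep_iff,
          restrict_indep_iff, and_iff_left hf.injOn, and_iff_left Sum.inl_injective.injOn,
          and_iff_left Subtype.val_injective.injOn]
        have h3 : Subtype.val '' I ⊆ X \ {e} := by
          rintro _ ⟨x, -, rfl⟩; exact x.2
        rw [and_iff_left h3, and_iff_left (h3.trans sdiff_subset)]
    rw [h1]
    exact hXe.comap Subtype.val_injective

variable {α : Type*} [Finite α] {K K' : Matroid (α ⊕ Unit)}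

lemma ext_baseRk_extRk (hK : K.E = univ) (hK' : K'.E = univ)
    (hb : ∀ X, baseRk K X = baseRk K' X) (he : ∀ X, extRk K X = extRk K' X) : K = K' := by
  refine ext_rk hK hK' fun A ↦ ?_
  have hA := image_preimage_inl_union_image_preimage_inr A
  by_cases h : Sum.inr () ∈ A
  · have h1 : A = insert (Sum.inr ()) (Sum.inl '' (Sum.inl ⁻¹' A)) := by
      ext (x | x) <;> simp [h]
    rw [h1]
    exact he _
  · have h1 : A = Sum.inl '' (Sum.inl ⁻¹' A) := by
      ext (x | x) <;> simp [h]
    rw [h1]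
    exact hb _

lemma extRk_le_succ (K : Matroid (α ⊕ Unit)) (X : Set α) : extRk K X ≤ baseRk K X + 1 :=
  K.rk_insert_le _ _

lemma baseRk_le_extRk (K : Matroid (α ⊕ Unit)) (X : Set α) : baseRk K X ≤ extRk K X :=
  rk_mono (subset_insert _ _)

lemma extRk_add_baseRk_le (K : Matroid (α ⊕ Unit)) {X Y : Set α} (h : X ⊆ Y) :
    extRk K Y + baseRk K X ≤ extRk K X + baseRk K Y := by
  have h1 := K.rk_inter_add_rk_union_le (insert (Sum.inr ()) (Sum.inl '' X)) (Sum.inl '' Y)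
  have h2 : baseRk K X ≤ K.rk (insert (Sum.inr ()) (Sum.inl '' X) ∩ Sum.inl '' Y) :=
    rk_mono (subset_inter (subset_insert _ _) (image_mono h))
  rw [insert_union, ← image_union, union_eq_self_of_subset_left h] at h1
  rw [extRk, extRk, baseRk.eq_1 K Y]
  omega

lemma isExtPair_of_extRk_univ {r : ℕ} (h : baseRk K univ = r) (h' : extRk K univ = r) :
    IsExtPair (baseRk K) (extRk K) r where
  mono _ _ hXY := baseRk_mono K hXY
  mono' _ _ hXY := extRk_mono K hXY
  le' := baseRk_le_extRk K
  le_succ := extRk_le_succ K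
  empty := by simp [baseRk]
  rank_eq := h
  rank_eq' := h'

/-- Otherwise `e` is a coloop and `K` is a direct sum of representable matroids. -/
lemma extRk_univ_eq {F : Type*} [Field F] (hK : K.E = univ) (hKF : ¬ K.IsRepresentable F)
    (hZ : (K.comap Sum.inl).IsRepresentable F) : extRk K univ = baseRk K univ := by
  by_contra hne
  have h1 := extRk_le_succ K univ
  have h2 := baseRk_le_extRk K univ
  have h3 : K = (K.comap Sum.inl).sum (freeOn (univ : Set Unit)) := by
    refine ext_baseRk_extRk hK (by simp [hK, range_inl_union_range_inr]) (fun X ↦ ?_) fun X ↦ ?_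
    · have := rk_sum (K.comap Sum.inl) (freeOn (univ : Set Unit)) X ∅
      rw [image_empty, union_empty, rk_empty, add_zero, rk_comap] at this
      exact this.symm
    · have := rk_sum (K.comap Sum.inl) (freeOn (univ : Set Unit)) X {()}
      rw [image_singleton, union_singleton, rk_freeOn_univ, ncard_singleton, rk_comap] at this
      refine Eq.trans ?_ this.symm
      have h4 := extRk_add_baseRk_le K (subset_univ X)
      have h5 := extRk_le_succ K X
      rw [← baseRk]
      omega
  rw [h3] at hKF
  exact hKF (hZ.sum isRepresentable_freeOn_univ)

/-- The hyperplanes of the matroid with rank function `q`. -/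
def hyperplanes (q : Set α → ℕ) : Set (Set α) :=
  {S | q S + 1 = q univ ∧ ∀ z ∉ S, q (insert z S) = q univ}

/-- A maximal set `S ⊇ X` that does not span `e` works: for `z ∉ S` the set `insert z S` spans `e`,
so by exchange `S` and `e` span `z`. Hence `S` with `e` spans everything. -/
lemma exists_hyperplane (h : extRk K univ = baseRk K univ) {X : Set α}
    (hX : extRk K X = baseRk K X + 1) :
    ∃ S ∈ hyperplanes (baseRk K), X ⊆ S ∧ extRk K S = baseRk K S + 1 := by
  obtain ⟨S, hXS, hS⟩ := (toFinite {S | extRk K S = baseRk K S + 1}).exists_le_maximal hX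
  have hS1 : extRk K S = baseRk K S + 1 := hS.prop
  have key : ∀ z ∉ S, baseRk K (insert z S) = baseRk K S + 1 ∧
      extRk K (insert z S) = extRk K S := fun z hz ↦ by
    have h1 : extRk K (insert z S) ≠ baseRk K (insert z S) + 1 := fun h1 ↦
      hz (hS.le_of_ge h1 (subset_insert z S) (mem_insert z S))
    have h2 := extRk_le_succ K (insert z S)
    have h3 := baseRk_le_extRk K (insert z S)
    have h4 := extRk_mono K (subset_insert z S)
    have h5 : baseRk K (insert z S) ≤ baseRk K S + 1 := by
      have := K.rk_insert_le (Sum.inl z) (Sum.inl '' S)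
      rwa [← image_insert_eq] at this
    omega
  have h1 : K.rk (insert (Sum.inr ()) (Sum.inl '' S) ∪ Sum.inl '' univ) = extRk K S := by
    refine rk_union_eq_of_forall K ?_
    rintro _ ⟨z, -, rfl⟩
    rw [insert_comm, ← image_insert_eq]
    by_cases hz : z ∈ S
    · rw [insert_eq_of_mem hz]
    · exact (key z hz).2
  rw [insert_union, ← image_union, union_univ] at h1
  have h2 : extRk K univ = extRk K S := h1
  exact ⟨S, ⟨by omega, fun z hz ↦ by have := (key z hz).1; omega⟩, hXS, hS1⟩

/-- Some representable extension of the same matroid agrees with `K` on the hyperplanes in `L`. -/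
def AgreeableOn (F : Type*) [Field F] (K : Matroid (α ⊕ Unit)) (L : Set (Set α)) : Prop :=
  ∃ K' : Matroid (α ⊕ Unit), K'.E = univ ∧ K'.IsRepresentable F ∧
    (∀ X, baseRk K' X = baseRk K X) ∧ extRk K' univ = baseRk K univ ∧
    ∀ S ∈ L, extRk K' S = extRk K S

variable {F : Type*} [Field F]

/-- An extension of the same rank is determined by the hyperplanes that span `e`, since a set not
spanning `e` lies in a hyperplane not spanning `e`. An extension agreeing with `K` on all
hyperplanes would be `K`. -/
lemma not_agreeableOn_hyperplanes (hK : K.E = univ) (hKF : ¬ K.IsRepresentable F)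
    (h : extRk K univ = baseRk K univ) : ¬ AgreeableOn F K (hyperplanes (baseRk K)) := by
  rintro ⟨K', hE, hF, hb, hu, hL⟩
  have hbK : baseRk K' = baseRk K := funext hb
  have main : ∀ K₁ K₂ : Matroid (α ⊕ Unit), baseRk K₁ = baseRk K₂ →
      extRk K₁ univ = baseRk K₁ univ →
      (∀ S ∈ hyperplanes (baseRk K₁), extRk K₁ S = extRk K₂ S) → ∀ X, extRk K₁ X ≤ extRk K₂ X := by
    intro K₁ K₂ hbb hu₁ hS X
    have h1 := extRk_le_succ K₁ X
    have h2 := baseRk_le_extRk K₂ X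
    by_cases hX : extRk K₁ X = baseRk K₁ X + 1
    · obtain ⟨S, hSh, hXS, hSe⟩ := exists_hyperplane hu₁ hX
      have h3 := hS S hSh
      have h4 := extRk_add_baseRk_le K₂ hXS
      have h5 := congrFun hbb S
      have h6 := congrFun hbb X
      omega
    · have h6 := congrFun hbb X
      omega
  refine hKF ?_
  rw [ext_baseRk_extRk hK hE (fun X ↦ (hb X).symm) fun X ↦ le_antisymm ?_ ?_]
  · exact hF
  · exact main K K' hbK.symm h (fun S hS ↦ (hL S hS).symm) X
  · exact main K' K hbK (hu.trans (hb univ).symm) (fun S hS ↦ hL S (hbK ▸ hS)) X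

lemma exists_extension_of_vector {n : ℕ} {w : α → Fin n → F}
    (hw : ∀ X, finrank F (span F (w '' X)) = baseRk K X) (x : Fin n → F)
    (hx : x ∈ span F (w '' univ)) :
    ∃ K' : Matroid (α ⊕ Unit), K'.E = univ ∧ K'.IsRepresentable F ∧
      (∀ X, baseRk K' X = baseRk K X) ∧ extRk K' univ = baseRk K univ ∧
      ∀ X, extRk K' X = finrank F (span F (insert x (w '' X))) := by
  obtain ⟨K', hE, hF, hr⟩ := exists_vectorMatroid F
    (Sum.elim w fun _ ↦ x : α ⊕ Unit → Fin n → F)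
  have h1 : ∀ X, extRk K' X = finrank F (span F (insert x (w '' X))) := fun X ↦ by
    rw [extRk, hr, image_insert_eq, image_image]
    rfl
  refine ⟨K', hE, hF, fun X ↦ ?_, ?_, h1⟩
  · rw [baseRk, hr, ← hw, image_image]
    rfl
  · rw [h1, ← hw, span_insert_eq_span hx]

/-- If `S` spans `e`, represent `e` by the zero vector; if not, by a copy of an element outside `S`.
-/
lemma agreeableOn_singleton (hZ : (K.comap Sum.inl).IsRepresentable F) (hK : K.E = univ)
    {S : Set α} (hS : S ∈ hyperplanes (baseRk K)) : AgreeableOn F K {S} := by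
  obtain ⟨n, w, hw⟩ := hZ.exists_finrank (by rw [comap_ground_eq, hK, preimage_univ])
  simp only [rk_comap] at hw
  have h1 := extRk_le_succ K S
  have h2 := baseRk_le_extRk K S
  by_cases h : extRk K S = baseRk K S
  · obtain ⟨K', hE, hF, hb, hu, hr⟩ := exists_extension_of_vector (K := K) hw 0 (zero_mem _)
    refine ⟨K', hE, hF, hb, hu, ?_⟩
    rintro _ rfl
    rw [hr, span_insert_zero, h, hw]
    rfl
  · obtain ⟨z, hz⟩ : ∃ z, z ∉ S := by
      by_contra! hc
      have := hS.1
      rw [eq_univ_of_forall hc] at this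
      omega
    obtain ⟨K', hE, hF, hb, hu, hr⟩ := exists_extension_of_vector (K := K) hw (w z)
      (subset_span ⟨z, mem_univ _, rfl⟩)
    refine ⟨K', hE, hF, hb, hu, ?_⟩
    rintro _ rfl
    rw [hr, ← image_insert_eq, hw]
    have := hS.2 z hz
    have := hS.1
    rw [baseRk] at *
    omega

/-- A minimal set of hyperplanes on which no representable extension agrees with `K`. -/
lemma exists_minimal_not_agreeableOn (hK : K.E = univ) (hKF : ¬ K.IsRepresentable F)
    (hZ : (K.comap Sum.inl).IsRepresentable F) :
    ∃ L ⊆ hyperplanes (baseRk K), ¬ AgreeableOn F K L ∧ L.Nontrivial ∧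
      ∀ S ∈ L, AgreeableOn F K (L \ {S}) ∧ AgreeableOn F K {S} := by
  have hu := extRk_univ_eq hK hKF hZ
  obtain ⟨L, hLH, hL⟩ := (toFinite {L | ¬ AgreeableOn F K L}).exists_le_minimal
    (not_agreeableOn_hyperplanes hK hKF hu)
  have hdel : ∀ S ∈ L, AgreeableOn F K (L \ {S}) := fun S hS ↦ by
    by_contra hc
    exact (hL.le_of_le hc sdiff_subset hS).2 rfl
  refine ⟨L, hLH, hL.prop, ?_, fun S hS ↦ ⟨hdel S hS, agreeableOn_singleton hZ hK (hLH hS)⟩⟩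
  rw [← not_subsingleton_iff]
  intro hsub
  rcases hsub.eq_empty_or_singleton with rfl | ⟨S, rfl⟩
  · obtain ⟨n, w, hw⟩ := hZ.exists_finrank (by rw [comap_ground_eq, hK, preimage_univ])
    simp only [rk_comap] at hw
    obtain ⟨K', hE, hF, hb, hu, -⟩ := exists_extension_of_vector (K := K) hw 0 (zero_mem _)
    exact hL.prop ⟨K', hE, hF, hb, hu, fun S hS ↦ hS.elim⟩
  · exact hL.prop (agreeableOn_singleton hZ hK (hLH rfl))

end SingleElementExtension

/-! ### Circuit elements cannot be removed -/

section EssentialElements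

variable {α ι κ : Type u}

lemma eq_gadgetSet (A : Set (((α ⊕ Option ι) ⊕ ι) ⊕ κ)) : ∃ X I B,
    A = gadgetSet X I B (Sum.inr ⁻¹' A) := by
  refine ⟨(fun a ↦ Sum.inl (Sum.inl (Sum.inl a))) ⁻¹' A,
    (fun j ↦ Sum.inl (Sum.inl (Sum.inr j))) ⁻¹' A, (fun i ↦ Sum.inl (Sum.inr i)) ⁻¹' A, ?_⟩
  ext (((x | x) | x) | x) <;> simp [gadgetSet, frameSet]

variable [Finite α] [Finite ι] [Finite κ]

variable {F : Type v} [Field F] [Infinite F] {K : Matroid (α ⊕ Unit)} {L : Set (Set α)}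
  {k : ℕ} {N : Matroid κ} {D : κ → L} {z : ι → α} {π : ι → L}
  {M : Matroid (((α ⊕ Option ι) ⊕ ι) ⊕ κ)}

lemma isHyperplaneFamily_of_subset (hL : L ⊆ hyperplanes (baseRk K)) :
    IsHyperplaneFamily (baseRk K) (baseRk K univ) (fun S : L ↦ (S : Set α)) where
  succ S := (hL S.2).1
  eq S X hX := by
    obtain ⟨x, hxX, hxS⟩ := not_subset.1 hX
    refine le_antisymm (baseRk_mono K (subset_univ _)) ?_
    rw [← (hL S.2).2 x hxS]
    exact baseRk_mono K (insert_subset (Or.inl hxX) subset_union_right)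
  inj := Subtype.val_injective

/-- If a representable extension agrees with `K` on `L'`, the rank function of the gadget
coincides on certain sets with that of a representable matroid. -/
lemma exists_representable_gadget (hu : extRk K univ = baseRk K univ)
    (hL : L ⊆ hyperplanes (baseRk K)) (hN : IsCircuitPartition N k D) (hNE : N.E = univ)
    (hNF : N.IsRepresentable F) (hz : ∀ s : L, z '' (π ⁻¹' {s}) = s)
    (hM : ∀ X I B Q, M.rk (gadgetSet X I B Q) =
      gadgetRk (baseRk K) (extRk K) z (fun y ↦ π ⁻¹' {D y}) N.rk X I B Q)
    {L' : Set (Set α)} (hA : AgreeableOn F K L') :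
    ∃ M' : Matroid (((α ⊕ Option ι) ⊕ ι) ⊕ κ), M'.E = univ ∧ M'.IsRepresentable F ∧
      ∀ A, (∀ s : L, D ⁻¹' {s} ⊆ Sum.inr ⁻¹' A →
        (s : Set α) ∈ L' ∨ k + 2 ≤ (Sum.inr ⁻¹' A : Set κ).ncard) → M.rk A = M'.rk A := by
  obtain ⟨K', hE, hF, hb, hu', hS⟩ := hA
  obtain ⟨M', hE', hC, hr⟩ := exists_gadget hE hNE z (fun y ↦ π ⁻¹' {D y})
  refine ⟨M', hE', (hC _ (MatroidClass.isExtensionClosed_representable F)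
    ⟨finite_of_finite, hF⟩ ⟨finite_of_finite, hNF⟩).2, fun A hQ ↦ ?_⟩
  obtain ⟨X, I, B, hA⟩ := eq_gadgetSet A
  rw [hA, hM, hr, show baseRk K' = baseRk K from funext hb]
  have hext : IsExtPair (baseRk K) (extRk K') (baseRk K univ) := by
    have := isExtPair_of_extRk_univ (hb univ) hu'
    rwa [show baseRk K' = baseRk K from funext hb] at this
  exact gadgetRk_eq_of_agree (isExtPair_of_extRk_univ rfl hu) hext
    (isHyperplaneFamily_of_subset hL) hN hz fun s hs ↦ (hQ s hs).imp_left fun h ↦ (hS _ h).symm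

/-- A set avoiding `y` does not contain the circuit of `D y`, so its rank ignores the hyperplane `D
y`; agreement on the remaining hyperplanes suffices. -/
lemma isRepresentable_delete_gadget (hu : extRk K univ = baseRk K univ)
    (hL : L ⊆ hyperplanes (baseRk K)) (hN : IsCircuitPartition N k D) (hNE : N.E = univ)
    (hNF : N.IsRepresentable F) (hz : ∀ s : L, z '' (π ⁻¹' {s}) = s)
    (hM : ∀ X I B Q, M.rk (gadgetSet X I B Q) =
      gadgetRk (baseRk K) (extRk K) z (fun y ↦ π ⁻¹' {D y}) N.rk X I B Q) (hE : M.E = univ)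
    (y : κ) (hA : AgreeableOn F K (L \ {↑(D y)})) : (M ＼ {Sum.inr y}).IsRepresentable F := by
  obtain ⟨M', hE', hF, hr⟩ := exists_representable_gadget hu hL hN hNE hNF hz hM hA
  have : M ＼ {Sum.inr y} = M' ＼ {Sum.inr y} := by
    refine ext_indep (by simp [hE, hE']) fun I hI ↦ ?_
    have hyI : Sum.inr y ∉ I := fun h ↦ by simpa using hI h
    rw [delete_indep_iff, delete_indep_iff, indep_iff_rk, indep_iff_rk, hr]
    intro s hs
    refine Or.inl ⟨s.2, fun h ↦ hyI ?_⟩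
    exact hs (show D y = s from Subtype.ext h.symm)
  rw [this]
  exact hF.delete _

/-- A set containing `y` and the circuit of some `s ≠ D y` has at least `k + 2` circuit elements, so
its rank ignores `s`; agreement on the single hyperplane `D y` suffices. -/
lemma isRepresentable_contract_gadget (hu : extRk K univ = baseRk K univ)
    (hL : L ⊆ hyperplanes (baseRk K)) (hN : IsCircuitPartition N k D) (hNE : N.E = univ)
    (hNF : N.IsRepresentable F) (hz : ∀ s : L, z '' (π ⁻¹' {s}) = s)
    (hM : ∀ X I B Q, M.rk (gadgetSet X I B Q) =
      gadgetRk (baseRk K) (extRk K) z (fun y ↦ π ⁻¹' {D y}) N.rk X I B Q) (hE : M.E = univ)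
    (y : κ) (hA : AgreeableOn F K {↑(D y)}) : (M ／ {Sum.inr y}).IsRepresentable F := by
  obtain ⟨M', hE', hF, hr⟩ := exists_representable_gadget hu hL hN hNE hNF hz hM hA
  have hrk : ∀ A, Sum.inr y ∈ A → M.rk A = M'.rk A := fun A hyA ↦ by
    refine hr A fun s hs ↦ ?_
    by_cases h : D y = s
    · exact Or.inl (congrArg Subtype.val h.symm)
    · right
      have h1 := ncard_le_ncard (insert_subset (show y ∈ Sum.inr ⁻¹' A from hyA) hs)
      rwa [ncard_insert_of_notMem (show y ∉ D ⁻¹' {s} from h), hN.ncard_fibre] at h1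
  have : M ／ {Sum.inr y} = M' ／ {Sum.inr y} := by
    refine ext_indep (by simp [hE, hE']) fun I hI ↦ ?_
    have hyI : Disjoint {Sum.inr y} I := disjoint_singleton_left.2 fun h ↦ by simpa using hI h
    rw [contract_indep_iff_rk hyI, contract_indep_iff_rk hyI, hrk _ (mem_singleton _),
      hrk _ (Or.inl (mem_singleton _))]
  rw [this]
  exact hF.contract _

end EssentialElements

lemma exists_minimal_minor {β : Type u} [Finite β] {F : Type v} [Field F] {M : Matroid β}
    (hM : ¬ M.IsRepresentable F) :
    ∃ M' : Matroid β, M'.IsMinor M ∧ M'.IsExcludedMinorForRepresentability F := by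
  obtain ⟨M', ⟨hM', hF⟩, hmin⟩ := (measure fun N : Matroid β ↦ N.E.ncard).wf.has_min
    {N | N.IsMinor M ∧ ¬ N.IsRepresentable F} ⟨M, IsMinor.refl, hM⟩
  refine ⟨M', hM', finite_of_finite, hF, fun N hN ↦ by_contra fun hc ↦ ?_⟩
  exact hmin N ⟨hN.isMinor.trans hM', hc⟩ (ncard_lt_ncard hN.ssubset)

end Matroid

/-! ### The excluded minor containing the given matroid -/

theorem theorem1p3 (F : Type v) [Field F] [Infinite F] (𝓜 : MatroidClass.{u})
    (hnat : 𝓜.IsNatural) (hproper : 𝓜.ProperlyContainsRepresentable F)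
    (α : Type u) (N : Matroid α) (hfin : N.Finite) (hN : N.IsRepresentable F) :
    ∃ (β : Type u) (M : Matroid β), 𝓜 β M ∧ M.IsExcludedMinorForRepresentability F ∧
      ∃ N' : Matroid β, N'.IsMinor M ∧ N.IsIsomorphic N' := by
  have hclosed := hnat.isExtensionClosed hproper
  obtain ⟨β, P, hP, hPF⟩ := hproper.2
  obtain ⟨α₀, _, K, hKE, hK𝓜, hKF, hZ⟩ :=
    exists_minimal_extension hclosed hP (hnat.finite _ _ hP) hPF
  have hu := extRk_univ_eq hKE hKF hZ
  obtain ⟨L, hLH, hLA, ⟨S₁, hS₁, S₂, hS₂, hS⟩, hLm⟩ := exists_minimal_not_agreeableOn hKE hKF hZ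
  have hs : (⟨S₁, hS₁⟩ : L) ≠ ⟨S₂, hS₂⟩ := fun h ↦ hS (congrArg Subtype.val h)
  -- One index for each hyperplane and each of its elements, so that different hyperplanes get
  -- disjoint copies.
  let ι : Type u := {p : L × α₀ // p.2 ∈ p.1.1}
  let z : ι → α₀ := fun i ↦ i.1.2
  let π : ι → L := fun i ↦ i.1.1
  have hz : ∀ s : L, z '' (π ⁻¹' {s}) = s := fun s ↦ by
    ext x
    constructor
    · rintro ⟨⟨⟨t, y⟩, hy⟩, rfl, rfl⟩
      exact hy
    · exact fun hx ↦ ⟨⟨(s, x), hx⟩, rfl, rfl⟩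
  obtain ⟨n, w, hw⟩ := hN
  have := hfin.ground_finite.to_subtype
  have := Fintype.ofFinite N.E
  -- The rank of the gadget without its circuit elements; `c + 1` blocks leave one undisturbed.
  set c := Nat.card (Option ι) + baseRk K univ with hc
  obtain ⟨N₀, hN₀E, hN₀F, hN₀, hN₀b, hN₀p⟩ :=
    exists_blockMatroid hs (fun j : N.E ↦ w j) (c + 1)
  obtain ⟨M, hME, hMC, hMr⟩ := exists_gadget hKE hN₀E z (fun y ↦ π ⁻¹' {Prod.fst y})
  have hM𝓜 : 𝓜 _ M := hMC 𝓜 hclosed hK𝓜 (hproper.1 _ _ finite_of_finite hN₀F)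
  have hext := isExtPair_of_extRk_univ (K := K) rfl hu
  have hMF : ¬ M.IsRepresentable F := fun hMF ↦ by
    obtain ⟨K', hE, hF, hb, hu', hL⟩ := exists_representable_extension hext
      (isHyperplaneFamily_of_subset hLH) hN₀ hz hs hME hMF hMr
    exact hLA ⟨K', hE, hF, hb, hu', fun S hS ↦ hL ⟨S, hS⟩⟩
  obtain ⟨M', hM', hM'F⟩ := exists_minimal_minor hMF
  obtain ⟨C, D, hCE, hDE, hCD, rfl⟩ := hM'.exists_eq_contract_delete_disjoint
  -- Removing a circuit element would make the excluded minor a minor of a representable matroid.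
  have hC : C ⊆ range Sum.inl := by
    rintro (x | y) hx
    · exact mem_range_self x
    refine absurd ?_ hM'F.not_isRepresentable
    rw [← insert_eq_of_mem hx, ← singleton_union, ← contract_contract]
    exact ((isRepresentable_contract_gadget hu hLH hN₀ hN₀E hN₀F hz hMr hME y
      (hLm _ y.1.2).2).contract _).delete _
  have hD : D ⊆ range Sum.inl := by
    rintro (x | y) hx
    · exact mem_range_self x
    refine absurd ?_ hM'F.not_isRepresentable
    rw [contract_delete_comm _ hCD, ← insert_eq_of_mem hx, ← singleton_union, ← delete_delete]
    exact ((isRepresentable_delete_gadget hu hLH hN₀ hN₀E hN₀F hz hMr hME y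
      (hLm _ y.1.2).1).delete _).contract _
  obtain ⟨N', hN', e, he, hN'E, hN'i⟩ := exists_isMinor_of_blocks (c := c) hs (fun j : N.E ↦ w j)
    hN₀.rk_univ hN₀b hN₀p hME (fun Q ↦ by
      rw [← gadgetRk_univ_left (fun y ↦ π ⁻¹' {Prod.fst y}) hext, ← hMr]
      congr
      simp [frameSet, range_inl_union_range_inr]) (Nat.lt_succ_self c) hC hD
  refine ⟨_, _, hnat.minor _ _ _ hM𝓜 hM', hM'F, N', hN', isIsomorphic_iff.2
    ⟨(Equiv.ofInjective e he).trans (Equiv.setCongr hN'E.symm), fun T ↦ ?_⟩⟩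
  rw [hw _ (by simp), linearIndepOn_image Subtype.val_injective.injOn, ← image_comp]
  exact (hN'i T).symm
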